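/- All graphs are finite, simple and undirected; $|G|$ denotes the number of vertices of $G$. A \emph{tree embedding} of a graph $G$ is a partial order on $V(G)$ such that the set of elements below any given vertex is totally ordered and any two adjacent vertices of $G$ are comparable. Its depth is the maximum over all vertices $v$ of the number of vertices strictly smaller than $v$. The \emph{treedepth} of $G$ is the minimum depth of a tree embedding of $G$; a class $\mathcal C$ of graphs has \emph{bounded treedepth} if there is a constant $d$ such that every graph of $\mathcal C$ has treedepth at most $d$. A graph $G$ is \emph{$H$-free} if there is no injection $V(H)\to V(G)$ that maps edges of $H$ to edges of $G$. For $\varepsilon>0$, $G$ is \emph{$\varepsilon$-far} from being $H$-free if more than $\varepsilon|G|$ edges have to be deleted from or inserted to $G$ to obtain an $H$-free graph on the same vertex set. In the \emph{random neighbor model}, a randomized algorithm knows the vertex set of its input graph $G$ and accesses $G$ only by (adaptive) random neighbor queries: given a vertex $v$, the oracle returns a neighbor of $v$ in $G$, chosen independently and uniformly at random among all neighbors of $v$ (or reports that $v$ has no neighbor). \textbf{Theorem.} Let $H$ be a graph and $\mathcal C$ a class of graphs of bounded treedepth. For every $\varepsilon>0$ there are a constant $q$ (depending only on $H$, $\mathcal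 C$ and $\varepsilon$) and a randomized algorithm in the random neighbor model that, on every input graph $G\in\mathcal C$, always halts after at most $q$ queries and \begin{itemize} \item accepts $G$ with probability $1$ if $G$ is $H$-free; \item rejects $G$ with probability at least $2/3$ if $G$ is $\varepsilon$-far from being $H$-free. \end{itemize} That is, the property of being $H$-free can be tested in the random neighbor model on graphs of $\mathcal C$ with constant query complexity and one-sided error. -/

import Mathlib

open scoped ENNReal

namespace GraphTesting

/-! ### Treedepth -/

/-- A tree order on `V`: a partial order in which the elements below any given element
are totally ordered. -/
structure IsTreeOrder {V : Type*} (le : V → V → Prop) : Prop where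
  refl : ∀ v, le v v
  antisymm : ∀ u v, le u v → le v u → u = v
  trans : ∀ u v w, le u v → le v w → le u w
  total_below : ∀ u v w, le u w → le v w → le u v ∨ le v u

/-- The level of `v`: the number of elements strictly smaller than `v`. Roots have level zero. -/
noncomputable def level {V : Type*} (le : V → V → Prop) (v : V) : ℕ :=
  {u : V | le u v ∧ u ≠ v}.ncard

/-- The depth of a tree order: the maximal level of its vertices. -/
noncomputable def depth {V : Type*} [Fintype V] (le : V → V → Prop) : ℕ :=
  Finset.univ.sup (level le)

/-- A tree embedding of `G`: a tree order on the vertices of `G` for which any two adjacent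
vertices are comparable. -/
structure IsTreeEmbedding {V : Type*} (G : SimpleGraph V) (le : V → V → Prop) : Prop where
  isTreeOrder : IsTreeOrder le
  comparable : ∀ u v, G.Adj u v → le u v ∨ le v u

/-- The treedepth of a finite graph: the minimum depth of its tree embeddings. (The set is
nonempty, as every linear order on the vertices is a tree embedding.) -/
noncomputable def treedepth {V : Type*} [Fintype V] (G : SimpleGraph V) : ℕ :=
  sInf {k : ℕ | ∃ le : V → V → Prop, IsTreeEmbedding G le ∧ depth le = k}

/-! ### Graph classes and graph properties

Graphs are finite and simple, with vertex set `{0, …, n - 1}`. -/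

/-- A class of graphs, or a property of graphs: a set of graphs on `{0, …, n - 1}`
for every `n`. -/
abbrev GraphClass : Type := (n : ℕ) → Set (SimpleGraph (Fin n))

/-- The graphs of the class have treedepth at most some constant `d`. -/
def HasBoundedTreedepth (C : GraphClass) : Prop :=
  ∃ d : ℕ, ∀ (n : ℕ) (G : SimpleGraph (Fin n)), G ∈ C n → treedepth G ≤ d

/-- The property of being `H`-free: there is no copy of `H` in the graph, i.e. no injection of
the vertices of `H` into those of the graph that maps edges to edges. -/
def hFree {W : Type*} (H : SimpleGraph W) : GraphClass :=
  fun _ => {G | H.Free G}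

/-- `G` is `ε`-far from `P`: more than `ε * |G|` edges have to be deleted from or inserted
to `G` to obtain a graph with property `P`. -/
def IsFar (P : GraphClass) (ε : ℝ) {n : ℕ} (G : SimpleGraph (Fin n)) : Prop :=
  ∀ G' : SimpleGraph (Fin n), G' ∈ P n →
    ε * (n : ℝ) < ((symmDiff G.edgeSet G'.edgeSet).ncard : ℝ)

/-! ### Testers in the random neighbor model -/

/-- What a tester may do next: make a random neighbor query at the vertex `v`, draw an integer
uniformly at random from `{0, …, m}` (no access to the graph), or stop and give its answer
(`true`: accept, `false`: reject). -/
inductive Action : Type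
  | query (v : ℕ) : Action
  | random (m : ℕ) : Action
  | answer (b : Bool) : Action

/-- Actions as a sum type, which makes them an effectively encoded type. -/
def Action.equivSum : Action ≃ ℕ ⊕ (ℕ ⊕ Bool) where
  toFun
    | .query v => Sum.inl v
    | .random m => Sum.inr (Sum.inl m)
    | .answer b => Sum.inr (Sum.inr b)
  invFun
    | Sum.inl v => .query v
    | Sum.inr (Sum.inl m) => .random m
    | Sum.inr (Sum.inr b) => .answer b
  left_inv a := by cases a <;> rfl
  right_inv a := by rcases a with v | m | b <;> rfl

instance : Primcodable Action := Primcodable.ofEquiv _ Action.equivSum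

/-- The action is a query to the oracle. -/
def Action.IsQuery : Action → Prop
  | .query _ => True
  | _ => False

/-- The list of the values received so far, in chronological order: outcomes of
the random draws and answers of the oracle. -/
abbrev Transcript : Type := List (Option ℕ)

/-- An algorithm with access to a random neighbor oracle. It knows the vertex set `{0, …, n - 1}`
of the input graph, and computes its next action from `n` and the values received so far. -/
structure Tester where
  next : ℕ → Transcript → Action
  computable : Computable₂ next

open Classical in
/-- The answer of the oracle for `G` to a query at `v`: a uniformly random neighbor of `v`, or
`none` if there is no such neighbor (`v` is isolated, or not a vertex). -/
noncomputable def randomNeighbor {n : ℕ} (G : SimpleGraph (Fin n)) (v : ℕ) : PMF (Option ℕ) :=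
  if h : ∃ hv : v < n, (G.neighborFinset ⟨v, hv⟩).Nonempty then
    (PMF.uniformOfFinset (G.neighborFinset ⟨v, h.1⟩) h.2).map fun w => some (w : ℕ)
  else
    PMF.pure none

namespace Tester

/-- One step of the tester on the input graph `G`. Nothing changes after it has answered. Fresh
randomness is used at every step. -/
noncomputable def step (T : Tester) {n : ℕ} (G : SimpleGraph (Fin n)) (t : Transcript) :
    PMF Transcript :=
  match T.next n t with
  | .query v => (randomNeighbor G v).map fun a => t ++ [a]
  | .random m => (PMF.uniformOfFintype (Fin (m + 1))).map fun k => t ++ [some (k : ℕ)]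
  | .answer _ => PMF.pure t

/-- The law of the transcript after `s` steps on the input graph `G`. -/
noncomputable def law (T : Tester) {n : ℕ} (G : SimpleGraph (Fin n)) : ℕ → PMF Transcript
  | 0 => PMF.pure []
  | s + 1 => (T.law G s).bind (T.step G)

/-- The number of queries made on a graph with `n` vertices in a run with transcript `t`. -/
noncomputable def numQueries (T : Tester) (n : ℕ) (t : Transcript) : ℕ :=
  {i : ℕ | i < t.length ∧ (T.next n (t.take i)).IsQuery}.ncard

/-- On the input graph `G`, every run of the tester stops with an answer, after having made at
most `q` queries. (As there are finitely many possible outcomes of each step, the number of steps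
is bounded if every run stops.) -/
def HaltsWithQueries (T : Tester) {n : ℕ} (G : SimpleGraph (Fin n)) (q : ℕ) : Prop :=
  ∃ s : ℕ, ∀ t ∈ (T.law G s).support,
    (∃ b : Bool, T.next n t = .answer b) ∧ T.numQueries n t ≤ q

/-- The probability that the tester answers `b` on the input graph `G`: the supremum (and limit)
over `s` of the probability that it has answered `b` within `s` steps. -/
noncomputable def probAnswer (T : Tester) {n : ℕ} (G : SimpleGraph (Fin n)) (b : Bool) : ℝ≥0∞ :=
  ⨆ s : ℕ, (T.law G s).toOuterMeasure {t | T.next n t = .answer b}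

end Tester

/-- `T` is a tester with one-sided error for the property `P` on graphs of the class `C`, with
proximity parameter `ε` and at most `q` queries. -/
structure IsOneSidedTester (P C : GraphClass) (ε : ℝ) (q : ℕ) (T : Tester) : Prop where
  halts : ∀ (n : ℕ) (G : SimpleGraph (Fin n)), G ∈ C n → T.HaltsWithQueries G q
  accepts : ∀ (n : ℕ) (G : SimpleGraph (Fin n)), G ∈ C n → G ∈ P n → T.probAnswer G true = 1
  rejects : ∀ (n : ℕ) (G : SimpleGraph (Fin n)), G ∈ C n → IsFar P ε G →
    2 / 3 ≤ T.probAnswer G false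

/-- In the random neighbor model, `P` is testable on graphs of `C` with constant query complexity
and one-sided error, for every proximity parameter `ε > 0`; the bound `q` on the number of queries
does not depend on the input graph. -/
def IsTestable (P C : GraphClass) : Prop :=
  ∀ ε : ℝ, 0 < ε → ∃ (q : ℕ) (T : Tester), IsOneSidedTester P C ε q T

end GraphTesting

/-!
If `G` is far from `H`-free, a maximal packing of edge-disjoint copies of `H` in `G` has linear
size, and some coloring of the vertices by `V(H)` makes a constant fraction of them colorful.
Cleaning applies each of its deletion rules at most once, and a rule deletes few edges compared
with the degree of a vertex, or with `|G|` for the one rule of each vertex of `H`. Bounded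
treedepth bounds the average degree and the number of rules at each vertex, so only few edges are
deleted and some colorful copy survives.

Suppose that the tester knows a proper subgraph of a surviving copy. Some edge `ab` of the copy is
unknown, say with `b` below `a`. If `a` is known, it has bounded degree, so a query at `a` finds
`b`. If `a` is unknown and no edge of `H` leaves the known part, then a random vertex plays the role
of `a` in a copy whose remaining part can be combined with the known one. Otherwise take an edge
`cc'` leaving the known part whose known end `c` is as high as possible in the tree: a query at `c`
finds `c'` in a copy that agrees with the given one below `c`, and since the unknown vertices above
`c` are joined to the others only through vertices below `c`, the two copies can be glued. Hence
each round enlarges the known part of some copy with constant probability. The error is one-sided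
as the tester rejects only if the edges it has seen contain a copy of `H`.
-/

namespace GraphTesting

open scoped Finset

/-! ### Probabilities of compound experiments -/

section PMF

variable {α β γ : Type*}

theorem mul_le_toOuterMeasure_bind {p : PMF α} {f : α → PMF β} {A : Set α} {B : Set β}
    {x y : ℝ≥0∞} (hA : x ≤ p.toOuterMeasure A) (hB : ∀ a ∈ A, y ≤ (f a).toOuterMeasure B) :
    x * y ≤ (p.bind f).toOuterMeasure B := by
  rw [PMF.toOuterMeasure_bind_apply]
  calc x * y ≤ p.toOuterMeasure A * y := by gcongr
    _ = ∑' a, A.indicator p a * y := by rw [PMF.toOuterMeasure_apply, ENNReal.tsum_mul_right]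
    _ ≤ ∑' a, p a * (f a).toOuterMeasure B := by
      refine ENNReal.tsum_le_tsum fun a => ?_
      by_cases ha : a ∈ A
      · rw [Set.indicator_of_mem ha]
        gcongr
        exact hB a ha
      · simp [ha]

theorem toOuterMeasure_bind_le_mul {p : PMF α} {f : α → PMF β} {A : Set α} {B : Set β}
    {x y : ℝ≥0∞} (hA : p.toOuterMeasure A ≤ x)
    (hB : ∀ a ∈ p.support, a ∈ A → (f a).toOuterMeasure B ≤ y)
    (h0 : ∀ a ∈ p.support, a ∉ A → (f a).toOuterMeasure B = 0) :
    (p.bind f).toOuterMeasure B ≤ x * y := by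
  rw [PMF.toOuterMeasure_bind_apply]
  calc ∑' a, p a * (f a).toOuterMeasure B ≤ ∑' a, A.indicator p a * y := by
        refine ENNReal.tsum_le_tsum fun a => ?_
        by_cases hs : p a = 0
        · simp [hs]
        have hs' : a ∈ p.support := (p.mem_support_iff a).2 hs
        by_cases ha : a ∈ A
        · rw [Set.indicator_of_mem ha]
          gcongr
          exact hB a hs' ha
        · simp [h0 a hs' ha]
    _ = p.toOuterMeasure A * y := by rw [PMF.toOuterMeasure_apply, ENNReal.tsum_mul_right]
    _ ≤ x * y := by gcongr

theorem toOuterMeasure_add_compl (p : PMF α) (A : Set α) :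
    p.toOuterMeasure A + p.toOuterMeasure Aᶜ = 1 := by
  rw [PMF.toOuterMeasure_apply, PMF.toOuterMeasure_apply, ← ENNReal.tsum_add, ← p.tsum_coe]
  refine tsum_congr fun a => ?_
  by_cases ha : a ∈ A <;> simp [ha]

theorem inv_le_toOuterMeasure_uniformOfFinset {s : Finset α} (hs : s.Nonempty) {A : Set α}
    (hA : A ⊆ s) {D : ℕ} (hD : D ≠ 0) (hcard : s.card ≤ D * A.ncard) :
    (D : ℝ≥0∞)⁻¹ ≤ (PMF.uniformOfFinset s hs).toOuterMeasure A := by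
  classical
  have hA' : (s.filter (· ∈ A)).card = A.ncard := by
    rw [← Set.ncard_coe_finset, Finset.coe_filter]
    congr 1
    exact Set.ext fun a => ⟨And.right, fun ha => ⟨hA ha, ha⟩⟩
  have hs0 : (s.card : ℝ≥0∞) ≠ 0 := Nat.cast_ne_zero.2 hs.card_ne_zero
  rw [PMF.toOuterMeasure_uniformOfFinset_apply, hA',
    ENNReal.le_div_iff_mul_le (.inl hs0) (.inl (ENNReal.natCast_ne_top _)), mul_comm,
    ← div_eq_mul_inv, ENNReal.div_le_iff_le_mul (.inl (Nat.cast_ne_zero.2 hD))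
      (.inl (ENNReal.natCast_ne_top _)), mul_comm]
  exact_mod_cast hcard

theorem inv_le_toOuterMeasure_uniformOfFintype [Fintype α] [Nonempty α] {A : Set α} {D : ℕ}
    (hD : D ≠ 0) (hcard : Nat.card α ≤ D * A.ncard) :
    (D : ℝ≥0∞)⁻¹ ≤ (PMF.uniformOfFintype α).toOuterMeasure A :=
  inv_le_toOuterMeasure_uniformOfFinset Finset.univ_nonempty (fun _ _ => by simp) hD
    (by rwa [Finset.card_univ, ← Nat.card_eq_fintype_card])

theorem map_bind_pure (p : PMF α) (g : α → β) (f : β → γ) :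
    (p.bind fun a => PMF.pure (g a)).map f = p.map fun a => f (g a) := by
  simp only [PMF.map_bind, PMF.pure_map]
  rfl

theorem exists_one_sub_pow_le {c x : ℝ≥0∞} (hc : c ≠ 0) (hx : 0 < x) :
    ∃ k : ℕ, (1 - c) ^ k ≤ x := by
  have hlt : 1 - c < 1 := ENNReal.sub_lt_self ENNReal.one_ne_top one_ne_zero hc
  have hlim := ENNReal.tendsto_pow_atTop_nhds_zero_of_lt_one hlt
  exact (hlim.eventually_le_const hx).exists

/-- The law of the state after `s` steps of the Markov chain with transition kernel `κ`, as a
function of the initial state. -/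
noncomputable def chain (κ : α → PMF α) : ℕ → α → PMF α
  | 0, a => PMF.pure a
  | s + 1, a => (chain κ s a).bind κ

theorem chain_one (κ : α → PMF α) : chain κ 1 = κ :=
  funext fun a => PMF.pure_bind a κ

theorem chain_add (κ : α → PMF α) (r s : ℕ) (a : α) :
    chain κ (r + s) a = (chain κ r a).bind (chain κ s) := by
  induction s with
  | zero => exact (PMF.bind_pure _).symm
  | succ s ih => rw [← Nat.add_assoc, chain, ih, PMF.bind_bind]; rfl

theorem chain_succ' (κ : α → PMF α) (s : ℕ) (a : α) :
    chain κ (s + 1) a = (κ a).bind (chain κ s) := by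
  rw [Nat.add_comm, chain_add, chain_one]

theorem pow_le_chain (κ : α → PMF α) (r : ℕ) {S : ℕ → Set α} {c : ℝ≥0∞} {L : ℕ} {a : α}
    (h0 : a ∈ S 0)
    (hS : ∀ j < L, ∀ b ∈ S j, c ≤ (chain κ r b).toOuterMeasure (S (j + 1))) :
    c ^ L ≤ (chain κ (r * L) a).toOuterMeasure (S L) := by
  induction L with
  | zero => simp [chain, h0]
  | succ L ih =>
    rw [Nat.mul_succ, chain_add, pow_succ]
    exact mul_le_toOuterMeasure_bind (ih fun j hj => hS j (by omega)) (hS L (by omega))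

theorem chain_le_pow (κ : α → PMF α) (r : ℕ) {B : Set α} {x : ℝ≥0∞} {k : ℕ} {a : α}
    (hB : ∀ j < k, ∀ b ∈ (chain κ (r * j) a).support, b ∈ B →
      (chain κ r b).toOuterMeasure B ≤ x)
    (h0 : ∀ j < k, ∀ b ∈ (chain κ (r * j) a).support, b ∉ B →
      (chain κ r b).toOuterMeasure B = 0) :
    (chain κ (r * k) a).toOuterMeasure B ≤ x ^ k := by
  induction k with
  | zero =>
    rw [pow_zero, ← toOuterMeasure_add_compl (chain κ (r * 0) a) B]
    exact le_self_add
  | succ k ih =>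
    rw [Nat.mul_succ, chain_add, pow_succ]
    exact toOuterMeasure_bind_le_mul
      (ih (fun j hj => hB j (by omega)) fun j hj => h0 j (by omega)) (hB k (by omega))
      (h0 k (by omega))

end PMF

/-! ### Computability of the search for a copy -/

section Primrec

variable {α : Type*} [Primcodable α]

theorem primrecPred_const (c : Prop) : PrimrecPred fun _ : α => c := by
  classical
  exact ⟨fun _ => Classical.dec c, Primrec.const _⟩

theorem primrecPred_forall {ι : Type*} [Finite ι] {p : ι → α → Prop}
    (hp : ∀ i, PrimrecPred (p i)) : PrimrecPred fun x => ∀ i, p i x := by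
  classical
  cases nonempty_fintype ι
  suffices h : ∀ s : Finset ι, PrimrecPred fun x => ∀ i ∈ s, p i x from
    (h Finset.univ).of_eq fun x => by simp only [Finset.mem_univ, true_imp_iff]
  intro s
  induction s using Finset.induction_on with
  | empty => exact (primrecPred_const True).of_eq fun x => by simp
  | insert i s _ ih => exact ((hp i).and ih).of_eq fun x => by simp

theorem primrecPred_imp {p : α → Prop} (c : Prop) (hp : PrimrecPred p) :
    PrimrecPred fun x => c → p x :=
  ((primrecPred_const c).not.or hp).of_eq fun _ => imp_iff_not_or.symm

theorem primrecPred_exists_lt {p : α → ℕ → Prop} {f : α → ℕ} (hf : Primrec f)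
    (hp : PrimrecRel p) : PrimrecPred fun x => ∃ i < f x, p x i :=
  (hp.swap.exists_mem_list.comp (Primrec.list_range.comp hf) Primrec.id).of_eq fun x => by
    simp only [List.mem_range, Function.swap, id_eq]

theorem primrec_nat_pow : Primrec₂ fun m k : ℕ => m ^ k :=
  Primrec₂.unpaired'.1 Nat.Primrec.pow

/-- The base `n` digits of `c` code the values of a map `W → Fin n`, which turns the search for a
copy into a bounded search over numbers. -/
theorem isContained_iff_exists_lt {W : Type*} [Fintype W] (H : SimpleGraph W) {n : ℕ}
    {G : SimpleGraph (Fin n)} {r : ℕ → ℕ → Prop} (hr : ∀ u v : Fin n, G.Adj u v ↔ r u v)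
    (e : W ≃ Fin (Fintype.card W)) :
    H.IsContained G ↔ ∃ c < n ^ Fintype.card W, ∀ a b,
      (a ≠ b → c / n ^ (e a : ℕ) % n ≠ c / n ^ (e b : ℕ) % n) ∧
      (H.Adj a b → r (c / n ^ (e a : ℕ) % n) (c / n ^ (e b : ℕ) % n)) := by
  constructor
  · rintro ⟨φ⟩
    have hφ (a : W) : (finFunctionFinEquiv (φ ∘ e.symm) : ℕ) / n ^ (e a : ℕ) % n = φ a := by
      rw [← finFunctionFinEquiv_symm_apply_val, Equiv.symm_apply_apply]
      simp
    refine ⟨finFunctionFinEquiv (φ ∘ e.symm), Fin.is_lt _,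
      fun a b => ⟨fun hab => ?_, fun hab => ?_⟩⟩
    · rw [hφ, hφ]
      exact fun h => hab (φ.injective (Fin.ext h))
    · rw [hφ, hφ, ← hr]
      exact φ.toHom.map_adj hab
  · rintro ⟨c, hc, h⟩
    let ψ : W → Fin n := finFunctionFinEquiv.symm ⟨c, hc⟩ ∘ e
    exact ⟨⟨⟨ψ, fun hab => (hr _ _).2 ((h _ _).2 hab)⟩, fun a b hab => by_contra fun hne =>
      (h a b).1 hne (congrArg Fin.val hab)⟩⟩

theorem primrecPred_isContained {W : Type*} [Finite W] (H : SimpleGraph W) {N : α → ℕ}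
    (hN : Primrec N) {G : ∀ x, SimpleGraph (Fin (N x))} {r : α → ℕ → ℕ → Prop}
    (hr : PrimrecPred fun y : α × ℕ × ℕ => r y.1 y.2.1 y.2.2)
    (hG : ∀ x u v, (G x).Adj u v ↔ r x u v) : PrimrecPred fun x => H.IsContained (G x) := by
  cases nonempty_fintype W
  let e := Fintype.equivFin W
  have hbound : Primrec fun x => N x ^ Fintype.card W := primrec_nat_pow.comp hN (Primrec.const _)
  refine PrimrecPred.of_eq (primrecPred_exists_lt hbound (p := fun x c => ∀ a b,
      (a ≠ b → c / N x ^ (e a : ℕ) % N x ≠ c / N x ^ (e b : ℕ) % N x) ∧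
      (H.Adj a b → r x (c / N x ^ (e a : ℕ) % N x) (c / N x ^ (e b : ℕ) % N x))) ?_)
    fun x => (isContained_iff_exists_lt H (hG x) e).symm
  have hN' : Primrec fun y : α × ℕ => N y.1 := hN.comp Primrec.fst
  have hdigit (a : W) : Primrec fun y : α × ℕ => y.2 / N y.1 ^ (e a : ℕ) % N y.1 :=
    Primrec.nat_mod.comp
      (Primrec.nat_div.comp Primrec.snd (primrec_nat_pow.comp hN' (Primrec.const _))) hN'
  exact primrecPred_forall fun a => primrecPred_forall fun b =>
    (primrecPred_imp _ (Primrec.eq.comp (hdigit a) (hdigit b)).not).and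
      (primrecPred_imp _ (hr.comp (Primrec.fst.pair ((hdigit a).pair (hdigit b)))))

end Primrec

/-! ### The exploring tester -/

/-- The vertex named by the last entry `p` of a transcript: it is the entry at distance `p + 1`
before that last one, and `0` if there is no such entry. -/
def lookup (t : Transcript) : ℕ :=
  (t.reverse.getD ((t.reverse.getD 0 none).getD 0 + 1) none).getD 0

theorem exists_lookup_eq_of_mem {u : Transcript} {v : ℕ} (hv : some v ∈ u) :
    ∃ p ≤ u.length, ∀ (t : Transcript) (r : Option ℕ), lookup (t ++ u ++ [r, some p]) = v := by
  obtain ⟨i, hi, hiv⟩ := List.getElem_of_mem (List.mem_reverse.2 hv)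
  rw [List.length_reverse] at hi
  refine ⟨i + 1, hi, fun t r => ?_⟩
  simp only [lookup, List.reverse_append, List.reverse_cons, List.reverse_nil, List.nil_append,
    List.cons_append, List.getD_cons_zero, List.getD_cons_succ, Option.getD_some]
  rw [List.getD_append _ _ _ _ (by simpa using hi), List.getD_eq_getElem _ _ (by simpa using hi),
    hiv, Option.getD_some]

/-- Some query of the run with transcript `t` was made at `x` and answered by `y`. Every third
action of the tester is a query. -/
def Reveals (t : Transcript) (x y : ℕ) : Prop :=
  ∃ i < t.length, i % 3 = 2 ∧ lookup (t.take i) = x ∧ t[i]? = some (some y)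

theorem reveals_append_singleton {t : Transcript} {a : Option ℕ} {x y : ℕ} :
    Reveals (t ++ [a]) x y ↔ Reveals t x y ∨ t.length % 3 = 2 ∧ lookup t = x ∧ a = some y := by
  constructor
  · rintro ⟨i, hi, hi3, hx, hy⟩
    rcases (Nat.lt_succ_iff.1 (by simpa using hi)).lt_or_eq with hlt | rfl
    · rw [List.take_append_of_le_length hlt.le] at hx
      rw [List.getElem?_append_left hlt] at hy
      exact .inl ⟨i, hlt, hi3, hx, hy⟩
    · exact .inr ⟨hi3, by simpa using hx, by simpa using hy⟩
  · rintro (⟨i, hlt, hi3, hx, hy⟩ | ⟨h3, hx, rfl⟩)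
    · refine ⟨i, by simp; omega, hi3, ?_, ?_⟩
      · rwa [List.take_append_of_le_length hlt.le]
      · rwa [List.getElem?_append_left hlt]
    · exact ⟨t.length, by simp, h3, by simpa using hx, by simp⟩

theorem Reveals.append {t : Transcript} {x y : ℕ} (h : Reveals t x y) (u : Transcript) :
    Reveals (t ++ u) x y := by
  induction u generalizing t with
  | nil => rwa [List.append_nil]
  | cons a u ih =>
    rw [List.append_cons]
    exact ih (reveals_append_singleton.2 (.inl h))

/-- The graph formed by the edges that the run with transcript `t` has revealed. -/
def revealedGraph (n : ℕ) (t : Transcript) : SimpleGraph (Fin n) :=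
  SimpleGraph.fromRel fun u v => Reveals t u v

theorem revealedGraph_adj {n : ℕ} {t : Transcript} {u v : Fin n} :
    (revealedGraph n t).Adj u v ↔ u ≠ v ∧ (Reveals t u v ∨ Reveals t v u) :=
  SimpleGraph.fromRel_adj _ u v

theorem revealedGraph_le_append (n : ℕ) (t u : Transcript) :
    revealedGraph n t ≤ revealedGraph n (t ++ u) := fun v w h => by
  rw [revealedGraph_adj] at h ⊢
  exact ⟨h.1, h.2.imp (·.append u) (·.append u)⟩

section Explore

variable {W : Type*} (H : SimpleGraph W)

open Classical in
/-- The strategy of the tester that searches for `H` in `R` rounds. A round consists of a random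
vertex, a random pointer `p ≤ m`, and a query at the vertex which `p` points to. In the end,
the tester accepts if the edges that it has seen contain no copy of `H`. -/
noncomputable def explore (m R n : ℕ) (t : Transcript) : Action :=
  if 3 * R ≤ t.length then .answer (decide (H.Free (revealedGraph n t)))
  else if t.length % 3 = 0 then .random (n - 1)
  else if t.length % 3 = 1 then .random m
  else .query (lookup t)

theorem primrec_lookup : Primrec lookup := by
  have hval : Primrec fun o : Option ℕ => o.getD 0 :=
    Primrec.option_getD.comp Primrec.id (Primrec.const 0)
  have hget := Primrec.list_getD (none : Option ℕ)
  exact hval.comp (hget.comp Primrec.list_reverse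
    (Primrec.succ.comp (hval.comp (hget.comp Primrec.list_reverse (Primrec.const 0)))))

theorem primrecPred_reveals :
    PrimrecPred fun y : Transcript × ℕ × ℕ => Reveals y.1 y.2.1 y.2.2 := by
  have ht : Primrec fun z : (Transcript × ℕ × ℕ) × ℕ => z.1.1 := Primrec.fst.comp Primrec.fst
  have hx : Primrec fun z : (Transcript × ℕ × ℕ) × ℕ => z.1.2 := Primrec.snd.comp Primrec.fst
  refine primrecPred_exists_lt (Primrec.list_length.comp Primrec.fst) (PrimrecPred.and ?_
    (PrimrecPred.and ?_ ?_))
  · exact Primrec.eq.comp (Primrec.nat_mod.comp Primrec.snd (Primrec.const 3)) (Primrec.const 2)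
  · exact Primrec.eq.comp (primrec_lookup.comp (Primrec.list_take.comp Primrec.snd ht))
      (Primrec.fst.comp hx)
  · exact Primrec.eq.comp (Primrec.list_getElem?.comp ht Primrec.snd)
      (Primrec.option_some.comp (Primrec.option_some.comp (Primrec.snd.comp hx)))

theorem primrecPred_isContained_revealedGraph [Finite W] :
    PrimrecPred fun x : ℕ × Transcript => H.IsContained (revealedGraph x.1 x.2) := by
  have ht : Primrec fun y : (ℕ × Transcript) × ℕ × ℕ => y.1.2 := Primrec.snd.comp Primrec.fst
  have hu : Primrec fun y : (ℕ × Transcript) × ℕ × ℕ => y.2.1 := Primrec.fst.comp Primrec.snd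
  have hv : Primrec fun y : (ℕ × Transcript) × ℕ × ℕ => y.2.2 := Primrec.snd.comp Primrec.snd
  refine primrecPred_isContained H (G := fun x => revealedGraph x.1 x.2) Primrec.fst
    (r := fun x u v => u ≠ v ∧ (Reveals x.2 u v ∨ Reveals x.2 v u)) ?_ fun x u v => ?_
  · exact (Primrec.eq.comp hu hv).not.and
      ((primrecPred_reveals.comp (ht.pair (hu.pair hv))).or
        (primrecPred_reveals.comp (ht.pair (hv.pair hu))))
  · rw [revealedGraph_adj, Ne, Fin.ext_iff]

theorem primrec_action_query : Primrec Action.query :=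
  (Primrec.of_equiv_symm (e := Action.equivSum)).comp Primrec.sumInl

theorem primrec_action_random : Primrec Action.random :=
  (Primrec.of_equiv_symm (e := Action.equivSum)).comp (Primrec.sumInr.comp Primrec.sumInl)

theorem primrec_action_answer : Primrec Action.answer :=
  (Primrec.of_equiv_symm (e := Action.equivSum)).comp (Primrec.sumInr.comp Primrec.sumInr)

theorem computable_explore [Finite W] (m R : ℕ) : Computable₂ (explore H m R) := by
  classical
  have hlen : Primrec fun x : ℕ × Transcript => x.2.length :=
    Primrec.list_length.comp Primrec.snd
  have hmod (i : ℕ) : PrimrecPred fun x : ℕ × Transcript => x.2.length % 3 = i :=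
    Primrec.eq.comp (Primrec.nat_mod.comp hlen (Primrec.const 3)) (Primrec.const i)
  refine Primrec.to_comp (Primrec.ite (Primrec.nat_le.comp (Primrec.const _) hlen) ?_
    (Primrec.ite (hmod 0) ?_ (Primrec.ite (hmod 1) ?_ ?_)))
  · exact primrec_action_answer.comp (primrecPred_isContained_revealedGraph H).not.decide
  · exact primrec_action_random.comp (Primrec.nat_sub.comp Primrec.fst (Primrec.const 1))
  · exact primrec_action_random.comp (Primrec.const m)
  · exact primrec_action_query.comp (primrec_lookup.comp Primrec.snd)

/-- The tester with the strategy `explore`. -/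
noncomputable def explorer [Finite W] (m R : ℕ) : Tester where
  next := explore H m R
  computable := computable_explore H m R

end Explore

/-! ### Runs of the exploring tester -/

section Runs

variable {n : ℕ} (G : SimpleGraph (Fin n))

theorem randomNeighbor_eq_map {v : Fin n} [Fintype (G.neighborSet v)]
    (h : (G.neighborFinset v).Nonempty) :
    randomNeighbor G v =
      (PMF.uniformOfFinset (G.neighborFinset v) h).map fun w : Fin n => some (w : ℕ) := by
  rw [randomNeighbor, dif_pos ⟨v.2, by convert h⟩]
  refine (map_bind_pure _ _ _).trans ?_
  congr!

theorem adj_of_mem_support_randomNeighbor {v w : ℕ}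
    (h : some w ∈ (randomNeighbor G v).support) :
    ∃ (hv : v < n) (hw : w < n), G.Adj ⟨v, hv⟩ ⟨w, hw⟩ := by
  classical
  by_cases hv : ∃ hv : v < n, (G.neighborFinset ⟨v, hv⟩).Nonempty
  · obtain ⟨hv, hne⟩ := hv
    rw [show v = ((⟨v, hv⟩ : Fin n) : ℕ) from rfl, randomNeighbor_eq_map G hne] at h
    simp only [PMF.mem_support_map_iff, PMF.mem_support_uniformOfFinset_iff,
      SimpleGraph.mem_neighborFinset, Option.some.injEq] at h
    obtain ⟨x, hx, rfl⟩ := h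
    exact ⟨hv, x.2, hx⟩
  · rw [randomNeighbor, dif_neg (by convert hv)] at h
    simp at h

theorem inv_le_toOuterMeasure_randomNeighbor {v : Fin n} {A : Set (Fin n)}
    (hA : A ⊆ G.neighborSet v) (hne : A.Nonempty) {D : ℕ} (hD : D ≠ 0)
    (hcard : (G.neighborSet v).ncard ≤ D * A.ncard) :
    (D : ℝ≥0∞)⁻¹ ≤ (randomNeighbor G v).toOuterMeasure ((fun w : Fin n => some (w : ℕ)) '' A) := by
  classical
  have hs : (G.neighborFinset v).Nonempty := by
    simpa [← Finset.coe_nonempty] using hne.mono hA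
  rw [randomNeighbor_eq_map G hs, PMF.toOuterMeasure_map_apply]
  refine (inv_le_toOuterMeasure_uniformOfFinset hs (A := A) (by simpa using hA) hD ?_).trans
    (MeasureTheory.measure_mono (Set.subset_preimage_image _ A))
  rwa [← Set.ncard_coe_finset, SimpleGraph.coe_neighborFinset]

/-- The law of the value that a tester receives after an action. No value is received after an
answer, where the law is a dummy. -/
noncomputable def reply : Action → PMF (Option ℕ)
  | .query v => randomNeighbor G v
  | .random m => (PMF.uniformOfFintype (Fin (m + 1))).map fun k : Fin (m + 1) => some (k : ℕ)
  | .answer _ => PMF.pure none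

theorem inv_le_toOuterMeasure_reply_random {m D : ℕ} {A : Set (Fin (m + 1))} (hD : D ≠ 0)
    (hcard : m + 1 ≤ D * A.ncard) :
    (D : ℝ≥0∞)⁻¹ ≤ (reply G (.random m)).toOuterMeasure
      ((fun w : Fin (m + 1) => some (w : ℕ)) '' A) := by
  rw [reply, PMF.toOuterMeasure_map_apply]
  exact (inv_le_toOuterMeasure_uniformOfFintype hD (by simpa using hcard)).trans
    (MeasureTheory.measure_mono (Set.subset_preimage_image _ A))

theorem inv_le_toOuterMeasure_reply_random_singleton {m p : ℕ} (hp : p ≤ m) :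
    ((m + 1 : ℕ) : ℝ≥0∞)⁻¹ ≤ (reply G (.random m)).toOuterMeasure {some p} := by
  refine (inv_le_toOuterMeasure_reply_random G (A := {⟨p, Nat.lt_succ_of_le hp⟩})
    m.succ_ne_zero (by simp)).trans_eq ?_
  rw [Set.image_singleton]

theorem Tester.law_eq_chain (T : Tester) (s : ℕ) : T.law G s = chain (T.step G) s [] := by
  induction s with
  | zero => rfl
  | succ s ih => rw [law, chain, ih]

theorem Tester.step_eq_map_reply (T : Tester) {t : Transcript}
    (h : ∀ b, T.next n t ≠ .answer b) :
    T.step G t = (reply G (T.next n t)).map fun a => t ++ [a] := by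
  unfold Tester.step
  rcases hT : T.next n t with v | m | b
  · rfl
  · -- The map over `Fin (m + 1)` in `Tester.step` goes through the coercion of the law to `ℕ`.
    rw [reply, PMF.map_comp]
    exact map_bind_pure _ _ _
  · exact absurd hT (h b)

variable {W : Type*} (H : SimpleGraph W) {m R : ℕ} {t : Transcript}

theorem explore_of_mod_eq_zero (hR : t.length < 3 * R) (h : t.length % 3 = 0) :
    explore H m R n t = .random (n - 1) := by
  rw [explore, if_neg hR.not_ge, if_pos h]

theorem explore_of_mod_eq_one (hR : t.length < 3 * R) (h : t.length % 3 = 1) :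
    explore H m R n t = .random m := by
  rw [explore, if_neg hR.not_ge, if_neg (by omega), if_pos h]

theorem explore_of_mod_eq_two (hR : t.length < 3 * R) (h : t.length % 3 = 2) :
    explore H m R n t = .query (lookup t) := by
  rw [explore, if_neg hR.not_ge, if_neg (by omega), if_neg (by omega)]

variable [Finite W]

theorem explorer_step (hR : t.length < 3 * R) :
    (explorer H m R).step G t = (reply G (explore H m R n t)).map fun a => t ++ [a] := by
  refine Tester.step_eq_map_reply G (explorer H m R) fun b => ?_
  have h3 : t.length % 3 = 0 ∨ t.length % 3 = 1 ∨ t.length % 3 = 2 := by omega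
  rcases h3 with h | h | h
  · simp [explorer, explore_of_mod_eq_zero H hR h]
  · simp [explorer, explore_of_mod_eq_one H hR h]
  · simp [explorer, explore_of_mod_eq_two H hR h]

theorem exists_append_of_mem_support_chain {s : ℕ} (hR : t.length + s ≤ 3 * R) {t' : Transcript}
    (ht : t' ∈ (chain ((explorer H m R).step G) s t).support) :
    ∃ u, u.length = s ∧ t' = t ++ u := by
  induction s generalizing t' with
  | zero => exact ⟨[], rfl, by simpa [chain] using ht⟩
  | succ s ih =>
    obtain ⟨_, h₁, ht⟩ := (PMF.mem_support_bind_iff _ _ _).1 ht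
    obtain ⟨u, hu, rfl⟩ := ih (by omega) h₁
    rw [explorer_step G H (by rw [List.length_append]; omega)] at ht
    obtain ⟨a, -, rfl⟩ := (PMF.mem_support_map_iff _ _ _).1 ht
    exact ⟨u ++ [a], by simp [hu], List.append_assoc _ _ _⟩

theorem toOuterMeasure_chain_eq_one {s : ℕ} (hR : t.length + s ≤ 3 * R) {S : Set Transcript}
    (hS : ∀ u : Transcript, u.length = s → t ++ u ∈ S) :
    (chain ((explorer H m R).step G) s t).toOuterMeasure S = 1 := by
  refine (PMF.toOuterMeasure_apply_eq_one_iff _ _).2 fun t' ht => ?_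
  obtain ⟨u, hu, rfl⟩ := exists_append_of_mem_support_chain G H hR ht
  exact hS u hu

theorem mul_le_toOuterMeasure_chain_succ {s : ℕ} (hR : t.length < 3 * R) {x y : ℝ≥0∞}
    {A : Set (Option ℕ)} {S : Set Transcript}
    (hA : x ≤ (reply G (explore H m R n t)).toOuterMeasure A)
    (hS : ∀ a ∈ A, y ≤ (chain ((explorer H m R).step G) s (t ++ [a])).toOuterMeasure S) :
    x * y ≤ (chain ((explorer H m R).step G) (s + 1) t).toOuterMeasure S := by
  rw [chain_succ', explorer_step G H hR, PMF.bind_map]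
  exact mul_le_toOuterMeasure_bind hA hS

theorem inv_le_toOuterMeasure_round_of_random (hR : t.length + 3 ≤ 3 * R)
    (h3 : t.length % 3 = 0) {A : Set (Fin n)} (hne : A.Nonempty) {D : ℕ} (hD : D ≠ 0)
    (hcard : n ≤ D * A.ncard) {S : Set Transcript}
    (hS : ∀ v ∈ A, ∀ p w, t ++ [some (v : ℕ), p, w] ∈ S) :
    (D : ℝ≥0∞)⁻¹ ≤ (chain ((explorer H m R).step G) 3 t).toOuterMeasure S := by
  obtain _ | k := n
  · exact hne.some.elim0
  rw [← mul_one (D : ℝ≥0∞)⁻¹]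
  refine mul_le_toOuterMeasure_chain_succ G H (by omega)
    (A := (fun w : Fin (k + 1) => some (w : ℕ)) '' A) ?_ ?_
  · rw [explore_of_mod_eq_zero H (by omega) h3]
    exact inv_le_toOuterMeasure_reply_random G hD hcard
  · rintro _ ⟨v, hv, rfl⟩
    refine (toOuterMeasure_chain_eq_one G H (by simp; omega) fun u hu => ?_).ge
    obtain ⟨p, w, rfl⟩ := List.length_eq_two.1 hu
    simpa using hS v hv p w

theorem inv_mul_inv_le_toOuterMeasure_round_of_query (hR : t.length + 3 ≤ 3 * R)
    (h3 : t.length % 3 = 0) {v : Fin n} {p : ℕ} (hp : p ≤ m)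
    (hv : ∀ r, lookup (t ++ [r, some p]) = v) {A : Set (Fin n)} (hA : A ⊆ G.neighborSet v)
    (hne : A.Nonempty) {D : ℕ} (hD : D ≠ 0) (hcard : (G.neighborSet v).ncard ≤ D * A.ncard)
    {S : Set Transcript} (hS : ∀ r, ∀ w ∈ A, t ++ [r, some p, some (w : ℕ)] ∈ S) :
    ((m + 1 : ℕ) : ℝ≥0∞)⁻¹ * (D : ℝ≥0∞)⁻¹ ≤
      (chain ((explorer H m R).step G) 3 t).toOuterMeasure S := by
  rw [← one_mul (_ * _)]
  refine mul_le_toOuterMeasure_chain_succ G H (A := Set.univ) (by omega)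
    ((PMF.toOuterMeasure_apply_eq_one_iff _ _).2 (Set.subset_univ _)).ge fun r _ => ?_
  refine mul_le_toOuterMeasure_chain_succ G H (A := {some p}) (by simp; omega) ?_ ?_
  · rw [explore_of_mod_eq_one H (by simp; omega) (by simp; omega)]
    exact inv_le_toOuterMeasure_reply_random_singleton G hp
  rintro _ rfl
  rw [← mul_one (D : ℝ≥0∞)⁻¹]
  refine mul_le_toOuterMeasure_chain_succ G H (A := (fun w : Fin n => some (w : ℕ)) '' A)
    (by simp; omega) ?_ ?_
  · rw [explore_of_mod_eq_two H (by simp; omega) (by simp; omega), List.append_assoc]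
    exact (inv_le_toOuterMeasure_randomNeighbor G hA hne hD hcard).trans_eq
      (by rw [reply, List.singleton_append, hv])
  · rintro _ ⟨w, hw, rfl⟩
    simp [chain, hS r w hw]

end Runs

/-! ### Explorable families of copies -/

section Explorable

variable {V W : Type*}

/-- The vertices that can play the role of `c` in a map of the family `Φ` that agrees with `φ`
on `K`. -/
def extensions (Φ : Set (W → V)) (φ : W → V) (K : Set W) (c : W) : Set V :=
  {v | ∃ ψ ∈ Φ, Set.EqOn ψ φ K ∧ ψ c = v}

theorem mem_extensions_self {Φ : Set (W → V)} {φ : W → V} (hφ : φ ∈ Φ) (K : Set W) (c : W) :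
    φ c ∈ extensions Φ φ K c :=
  ⟨φ, hφ, Set.eqOn_refl _ _, rfl⟩

/-- A family of copies of `H` in `G` that random exploration discovers: whenever only a proper
subgraph `K` of `H` is known in a copy of the family, another copy of the family that agrees with it
on `K` is hit with probability at least `1 / D` by a random vertex, or by a random neighbor of a
known vertex, the latter revealing a new edge. -/
structure IsExplorable (H : SimpleGraph W) (G : SimpleGraph V) (D : ℕ) (Φ : Set (W → V)) :
    Prop where
  nonempty : Φ.Nonempty
  injective : ∀ φ ∈ Φ, Function.Injective φ
  map_adj : ∀ φ ∈ Φ, ∀ ⦃a b⦄, H.Adj a b → G.Adj (φ a) (φ b)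
  extend : ∀ φ ∈ Φ, ∀ K : H.Subgraph, K.spanningCoe < H →
    (∃ c ∉ K.verts, Nat.card V ≤ D * (extensions Φ φ K.verts c).ncard) ∨
    ∃ c ∈ K.verts, ∃ c', H.Adj c c' ∧ ¬K.Adj c c' ∧
      (G.neighborSet (φ c)).ncard ≤ D * (extensions Φ φ K.verts c').ncard

end Explorable

/-! ### Progress of the exploration -/

section Progress

variable {n : ℕ} {W : Type*} (H : SimpleGraph W) {φ ψ : W → Fin n} {t₀ u x : Transcript} {j : ℕ}

/-- The part of `H` that is known in the copy `φ` when the transcript `t₀` has been continued by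
`u`. Only the vertices that occur in `u` count as known, so that a pointer bounded by the length of
`u` reaches each of them. -/
def knownPart (t₀ u : Transcript) (φ : W → Fin n) : H.Subgraph where
  verts := {a | some (φ a : ℕ) ∈ u}
  Adj a b := H.Adj a b ∧ some (φ a : ℕ) ∈ u ∧ some (φ b : ℕ) ∈ u ∧
    (revealedGraph n (t₀ ++ u)).Adj (φ a) (φ b)
  adj_sub h := h.1
  edge_vert h := h.2.1
  symm := ⟨fun _ _ h => ⟨h.1.symm, h.2.2.1, h.2.1, h.2.2.2.symm⟩⟩

theorem knownPart_le_append (x : Transcript) (h : Set.EqOn ψ φ (knownPart H t₀ u φ).verts) :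
    knownPart H t₀ u φ ≤ knownPart H t₀ (u ++ x) ψ := by
  have hverts : (knownPart H t₀ u φ).verts ⊆ (knownPart H t₀ (u ++ x) ψ).verts := fun a ha => by
    change some (ψ a : ℕ) ∈ u ++ x
    rw [h ha]
    exact List.mem_append_left x ha
  refine ⟨hverts, fun a b ⟨hH, ha, hb, hab⟩ => ⟨hH, hverts ha, hverts hb, ?_⟩⟩
  rw [h ha, h hb, ← List.append_assoc]
  exact revealedGraph_le_append n _ x hab

theorem knownPart_lt_append_of_vert (h : Set.EqOn ψ φ (knownPart H t₀ u φ).verts) {c : W}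
    (hc : c ∉ (knownPart H t₀ u φ).verts) (hx : some (ψ c : ℕ) ∈ x) :
    knownPart H t₀ u φ < knownPart H t₀ (u ++ x) ψ :=
  (knownPart_le_append H x h).lt_of_not_ge fun hle => hc (hle.1 (List.mem_append_right u hx))

theorem knownPart_lt_append_of_adj (h : Set.EqOn ψ φ (knownPart H t₀ u φ).verts) {c c' : W}
    (hc : c ∈ (knownPart H t₀ u φ).verts) (hadj : H.Adj c c')
    (hnadj : ¬(knownPart H t₀ u φ).Adj c c') (hx : some (ψ c' : ℕ) ∈ x)
    (hrev : (revealedGraph n (t₀ ++ u ++ x)).Adj (ψ c) (ψ c')) :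
    knownPart H t₀ u φ < knownPart H t₀ (u ++ x) ψ :=
  have hle := knownPart_le_append H x h
  hle.lt_of_not_ge fun hge => hnadj <|
    hge.2 ⟨hadj, hle.1 hc, List.mem_append_right u hx, by rwa [← List.append_assoc]⟩

/-- The transcripts at the end of the `j`-th round after `t₀` in which some copy of the family `Φ`
is known completely, or its known part has at least `j` proper subgraphs. -/
def stage (Φ : Set (W → Fin n)) (t₀ : Transcript) (j : ℕ) : Set Transcript :=
  {t | ∃ u, t = t₀ ++ u ∧ u.length = 3 * j ∧ ∃ φ ∈ Φ,
    (knownPart H t₀ u φ).spanningCoe = H ∨ j ≤ (Set.Iio (knownPart H t₀ u φ)).ncard}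

variable {Φ : Set (W → Fin n)}

theorem mem_stage_zero (hΦ : Φ.Nonempty) (t₀ : Transcript) : t₀ ∈ stage H Φ t₀ 0 :=
  let ⟨φ, hφ⟩ := hΦ
  ⟨[], (List.append_nil t₀).symm, rfl, φ, hφ, .inr (Nat.zero_le _)⟩

theorem append_mem_stage_of_eq (hφ : φ ∈ Φ) (hu : u.length = 3 * j) (hx : x.length = 3)
    (h : (knownPart H t₀ u φ).spanningCoe = H) : t₀ ++ u ++ x ∈ stage H Φ t₀ (j + 1) := by
  refine ⟨u ++ x, List.append_assoc _ _ _, by simp [hu, hx, mul_add], φ, hφ, .inl ?_⟩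
  exact (SimpleGraph.Subgraph.spanningCoe_le _).antisymm
    (h.ge.trans (knownPart_le_append H x fun _ _ => rfl).2)

variable [Finite W]

theorem append_mem_stage_of_lt (hψ : ψ ∈ Φ) (hu : u.length = 3 * j) (hx : x.length = 3)
    (hj : j ≤ (Set.Iio (knownPart H t₀ u φ)).ncard)
    (hlt : knownPart H t₀ u φ < knownPart H t₀ (u ++ x) ψ) :
    t₀ ++ u ++ x ∈ stage H Φ t₀ (j + 1) :=
  ⟨u ++ x, List.append_assoc _ _ _, by simp [hu, hx, mul_add], ψ, hψ,
    .inr (hj.trans_lt (Set.ncard_strictMono (Set.Iio_ssubset_Iio hlt)))⟩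

theorem isContained_of_mem_stage (hΦ : ∀ φ ∈ Φ, Function.Injective φ) {t : Transcript}
    (ht : t ∈ stage H Φ t₀ (Nat.card H.Subgraph)) : H.IsContained (revealedGraph n t) := by
  obtain ⟨u, rfl, -, φ, hφ, hfound | hcard⟩ := ht
  · refine ⟨⟨⟨φ, fun {a b} hab => ?_⟩, hΦ φ hφ⟩⟩
    rw [← hfound] at hab
    exact hab.2.2.2
  · have hlt : (Set.Iio (knownPart H t₀ u φ)).ncard < Nat.card H.Subgraph :=
      Set.ncard_lt_card fun h => lt_irrefl (knownPart H t₀ u φ) (h.ge (Set.mem_univ _))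
    exact absurd hcard hlt.not_ge

variable {H} {D m R : ℕ} {G : SimpleGraph (Fin n)}

theorem IsExplorable.le_round_of_adj (hΦ : IsExplorable H G D Φ) (hD : D ≠ 0)
    (hmod : (t₀ ++ u).length % 3 = 0) (hR : (t₀ ++ u).length + 3 ≤ 3 * R)
    (hu : u.length = 3 * j) (hm : 3 * j ≤ m) (hφ : φ ∈ Φ)
    (hj : j ≤ (Set.Iio (knownPart H t₀ u φ)).ncard) {c c' : W}
    (hc : c ∈ (knownPart H t₀ u φ).verts) (hadj : H.Adj c c')
    (hnadj : ¬(knownPart H t₀ u φ).Adj c c')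
    (hcard : (G.neighborSet (φ c)).ncard ≤
      D * (extensions Φ φ (knownPart H t₀ u φ).verts c').ncard) :
    ((m + 1 : ℕ) : ℝ≥0∞)⁻¹ * (D : ℝ≥0∞)⁻¹ ≤
      (chain ((explorer H m R).step G) 3 (t₀ ++ u)).toOuterMeasure (stage H Φ t₀ (j + 1)) := by
  obtain ⟨p, hp, hlookup⟩ := exists_lookup_eq_of_mem hc
  refine inv_mul_inv_le_toOuterMeasure_round_of_query G H hR hmod (by omega) (hlookup t₀) ?_
    ⟨_, mem_extensions_self hφ _ c'⟩ hD hcard ?_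
  · rintro _ ⟨ψ, hψ, hEq, rfl⟩
    rw [SimpleGraph.mem_neighborSet, ← hEq hc]
    exact hΦ.map_adj ψ hψ hadj
  · rintro r _ ⟨ψ, hψ, hEq, rfl⟩
    have hrev : Reveals (t₀ ++ u ++ [r, some p] ++ [some (ψ c' : ℕ)]) (ψ c) (ψ c') :=
      reveals_append_singleton.2 (.inr ⟨by
        rw [List.length_append, List.length_cons, List.length_singleton]; omega,
        by rw [hlookup, hEq hc], rfl⟩)
    refine append_mem_stage_of_lt H hψ hu rfl hj
      (knownPart_lt_append_of_adj H hEq hc hadj hnadj (by simp) (revealedGraph_adj.2 ?_))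
    exact ⟨(hΦ.injective ψ hψ).ne hadj.ne, .inl (by simpa using hrev)⟩

theorem IsExplorable.le_round (hΦ : IsExplorable H G D Φ) (hD : D ≠ 0) {t : Transcript}
    (h0 : t₀.length % 3 = 0) (hR : t₀.length + 3 * (j + 1) ≤ 3 * R) (hm : 3 * j ≤ m)
    (ht : t ∈ stage H Φ t₀ j) :
    ((m + 1 : ℕ) : ℝ≥0∞)⁻¹ * (D : ℝ≥0∞)⁻¹ ≤
      (chain ((explorer H m R).step G) 3 t).toOuterMeasure (stage H Φ t₀ (j + 1)) := by
  obtain ⟨u, rfl, hu, φ, hφ, hknown⟩ := ht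
  have hlen : (t₀ ++ u).length = t₀.length + 3 * j := by rw [List.length_append, hu]
  have hround : (t₀ ++ u).length + 3 ≤ 3 * R := by omega
  have hmod : (t₀ ++ u).length % 3 = 0 := by omega
  have hm1 : ((m + 1 : ℕ) : ℝ≥0∞)⁻¹ ≤ 1 := ENNReal.inv_le_one.2 (by simp)
  by_cases hfound : (knownPart H t₀ u φ).spanningCoe = H
  · rw [toOuterMeasure_chain_eq_one G H hround
      fun x hx => append_mem_stage_of_eq H hφ hu hx hfound]
    exact mul_le_one' hm1 (ENNReal.inv_le_one.2 (by exact_mod_cast Nat.one_le_iff_ne_zero.2 hD))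
  have hj := hknown.resolve_left hfound
  rcases hΦ.extend φ hφ _ ((SimpleGraph.Subgraph.spanningCoe_le _).lt_of_ne hfound) with
    ⟨c, hc, hcard⟩ | ⟨c, hc, c', hadj, hnadj, hcard⟩
  · refine (mul_le_of_le_one_left' hm1).trans
      (inv_le_toOuterMeasure_round_of_random G H hround hmod
        ⟨_, mem_extensions_self hφ _ c⟩ hD (by simpa using hcard) ?_)
    rintro _ ⟨ψ, hψ, hEq, rfl⟩ p w
    exact append_mem_stage_of_lt H hψ hu rfl hj (knownPart_lt_append_of_vert H hEq hc (by simp))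
  · exact hΦ.le_round_of_adj hD hmod hround hu hm hφ hj hc hadj hnadj hcard

theorem IsExplorable.pow_le_block (hΦ : IsExplorable H G D Φ) (hD : D ≠ 0)
    (h0 : t₀.length % 3 = 0) (hR : t₀.length + 3 * Nat.card H.Subgraph ≤ 3 * R)
    (hm : 3 * Nat.card H.Subgraph ≤ m) :
    (((m + 1 : ℕ) : ℝ≥0∞)⁻¹ * (D : ℝ≥0∞)⁻¹) ^ Nat.card H.Subgraph ≤
      (chain ((explorer H m R).step G) (3 * Nat.card H.Subgraph) t₀).toOuterMeasure
        {t | H.IsContained (revealedGraph n t)} :=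
  (pow_le_chain _ 3 (mem_stage_zero H hΦ.nonempty t₀) fun j hj _ ht =>
    hΦ.le_round hD h0 (by omega) (by omega) ht).trans
    (MeasureTheory.measure_mono fun _ => isContained_of_mem_stage H hΦ.injective)

end Progress

section Tester

variable {n : ℕ} {G : SimpleGraph (Fin n)} {W : Type*} [Finite W] {H : SimpleGraph W} {D m R : ℕ}

theorem free_le_pow (hΦ : ∃ Φ, IsExplorable H G D Φ) (hD : D ≠ 0)
    (hm : 3 * Nat.card H.Subgraph ≤ m) {k : ℕ} (hR : Nat.card H.Subgraph * k ≤ R) :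
    (chain ((explorer H m R).step G) (3 * Nat.card H.Subgraph * k) []).toOuterMeasure
        {t | H.Free (revealedGraph n t)} ≤
      (1 - (((m + 1 : ℕ) : ℝ≥0∞)⁻¹ * (D : ℝ≥0∞)⁻¹) ^ Nat.card H.Subgraph) ^ k := by
  obtain ⟨Φ, hΦ⟩ := hΦ
  set L := Nat.card H.Subgraph
  have hlen : ∀ j < k, ∀ t ∈ (chain ((explorer H m R).step G) (3 * L * j) []).support,
      t.length = 3 * (L * j) ∧ t.length + 3 * L ≤ 3 * R := fun j hj t ht => by
    have hjk : L * (j + 1) ≤ R := (Nat.mul_le_mul_left L hj).trans hR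
    rw [mul_add, mul_one] at hjk
    obtain ⟨u, hu, rfl⟩ := exists_append_of_mem_support_chain G H
      (by simp only [List.length_nil, mul_assoc]; omega) ht
    simp only [hu, mul_assoc, true_and]
    omega
  refine chain_le_pow _ _ (fun j hj t ht _ => ?_) fun j hj t ht hcontained => ?_
  · obtain ⟨ht, hR⟩ := hlen j hj t ht
    refine ENNReal.le_sub_of_add_le_right (by finiteness) ?_
    rw [← toOuterMeasure_add_compl (chain _ _ t) {t | H.Free (revealedGraph n t)}]
    gcongr
    simpa [SimpleGraph.Free, Set.compl_ofPred] using hΦ.pow_le_block hD (by omega) hR hm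
  · refine (PMF.toOuterMeasure_apply_eq_zero_iff _ _).2 (Set.disjoint_left.2 fun t' ht' => ?_)
    obtain ⟨u, -, rfl⟩ := exists_append_of_mem_support_chain G H (hlen j hj t ht).2 ht'
    exact fun h => hcontained fun hc => h (hc.mono_right (revealedGraph_le_append n t u))

variable (G H m R)

theorem revealedGraph_le_of_mem_support {s : ℕ} (hs : s ≤ 3 * R) {t : Transcript}
    (ht : t ∈ (chain ((explorer H m R).step G) s []).support) : revealedGraph n t ≤ G := by
  suffices h : ∀ u v : Fin n, Reveals t u v → G.Adj u v from fun u v huv =>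
    (revealedGraph_adj.1 huv).2.elim (h u v) fun hvu => (h v u hvu).symm
  induction s generalizing t with
  | zero =>
    obtain rfl : t = [] := by simpa [chain] using ht
    rintro u v ⟨i, hi, -⟩
    simp at hi
  | succ s ih =>
    obtain ⟨t₁, h₁, ht⟩ := (PMF.mem_support_bind_iff _ _ _).1 ht
    obtain ⟨_, hlen, rfl⟩ := exists_append_of_mem_support_chain G H (by simp; omega) h₁
    have hlt : t₁.length < 3 * R := by omega
    rw [explorer_step G H hlt] at ht
    obtain ⟨a, ha, rfl⟩ := (PMF.mem_support_map_iff _ _ _).1 ht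
    intro u v huv
    rcases reveals_append_singleton.1 huv with h | ⟨h3, hu, rfl⟩
    · exact ih (by omega) h₁ u v h
    · rw [explore_of_mod_eq_two H hlt h3, hu] at ha
      exact (adj_of_mem_support_randomNeighbor G ha).2.2

open Classical in
theorem explorer_next_of_mem_support_law {t : Transcript}
    (ht : t ∈ ((explorer H m R).law G (3 * R)).support) :
    (explorer H m R).next n t = .answer (decide (H.Free (revealedGraph n t))) := by
  rw [Tester.law_eq_chain] at ht
  obtain ⟨u, hu, rfl⟩ := exists_append_of_mem_support_chain G H (by simp) ht
  exact if_pos hu.ge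

theorem Tester.numQueries_le_length (T : Tester) (n : ℕ) (t : Transcript) :
    T.numQueries n t ≤ t.length :=
  (Set.ncard_le_ncard (fun _ hi => hi.1) (Set.finite_Iio _)).trans_eq (Set.ncard_Iio_nat _)

theorem explorer_haltsWithQueries : (explorer H m R).HaltsWithQueries G (3 * R) := by
  refine ⟨3 * R, fun t ht => ⟨⟨_, explorer_next_of_mem_support_law G H m R ht⟩, ?_⟩⟩
  rw [Tester.law_eq_chain] at ht
  obtain ⟨u, hu, rfl⟩ := exists_append_of_mem_support_chain G H (by simp) ht
  exact (Tester.numQueries_le_length _ n t).trans hu.le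

theorem explorer_probAnswer_true (h : H.Free G) : (explorer H m R).probAnswer G true = 1 := by
  refine le_antisymm (iSup_le fun s => ?_) (le_iSup_of_le (3 * R) (Eq.ge ?_))
  · rw [← toOuterMeasure_add_compl ((explorer H m R).law G s)]
    exact le_self_add
  · refine (PMF.toOuterMeasure_apply_eq_one_iff _ _).2 fun t ht => ?_
    have hnext := explorer_next_of_mem_support_law G H m R ht
    rw [Tester.law_eq_chain] at ht
    have hfree : H.Free (revealedGraph n t) := fun hcopy =>
      h (hcopy.mono_right (revealedGraph_le_of_mem_support G H m R le_rfl ht))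
    simpa [hfree] using hnext

theorem le_explorer_probAnswer_false
    (h : (chain ((explorer H m R).step G) (3 * R) []).toOuterMeasure
      {t | H.Free (revealedGraph n t)} ≤ 1 / 3) :
    2 / 3 ≤ (explorer H m R).probAnswer G false := by
  rw [← Tester.law_eq_chain] at h
  have hsum := toOuterMeasure_add_compl ((explorer H m R).law G (3 * R))
    {t | H.Free (revealedGraph n t)}
  have hthirds : (1 / 3 + 2 / 3 : ℝ≥0∞) = 1 := by
    rw [ENNReal.div_add_div_same, show (1 + 2 : ℝ≥0∞) = 3 by norm_num]
    exact ENNReal.div_self (by simp) (by simp)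
  calc (2 / 3 : ℝ≥0∞)
      ≤ ((explorer H m R).law G (3 * R)).toOuterMeasure {t | H.Free (revealedGraph n t)}ᶜ := by
        refine ENNReal.le_of_add_le_add_left (a := 1 / 3) (by simp) ?_
        exact (hthirds.trans hsum.symm).le.trans (by gcongr)
    _ ≤ ((explorer H m R).law G (3 * R)).toOuterMeasure
          {t | (explorer H m R).next n t = .answer false} := by
        refine PMF.toOuterMeasure_mono _ fun t ⟨hfound, ht⟩ => ?_
        have hnext := explorer_next_of_mem_support_law G H m R ht
        have hcopy : ¬H.Free (revealedGraph n t) := hfound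
        simpa [hcopy] using hnext
    _ ≤ (explorer H m R).probAnswer G false := le_iSup_of_le (3 * R) le_rfl

end Tester

theorem exists_isOneSidedTester {W : Type*} [Finite W] (H : SimpleGraph W) {C : GraphClass}
    {ε : ℝ} {D : ℕ} (hD : D ≠ 0)
    (hfar : ∀ (n : ℕ) (G : SimpleGraph (Fin n)), G ∈ C n → IsFar (hFree H) ε G →
      ∃ Φ, IsExplorable H G D Φ) :
    ∃ (q : ℕ) (T : Tester), IsOneSidedTester (hFree H) C ε q T := by
  set L := Nat.card H.Subgraph
  have hc : (((3 * L + 1 : ℕ) : ℝ≥0∞)⁻¹ * (D : ℝ≥0∞)⁻¹) ^ L ≠ 0 :=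
    pow_ne_zero _ (mul_ne_zero (ENNReal.inv_ne_zero.2 (by finiteness))
      (ENNReal.inv_ne_zero.2 (by finiteness)))
  obtain ⟨k, hk⟩ := exists_one_sub_pow_le (x := 1 / 3) hc (by simp)
  refine ⟨3 * (L * k), explorer H (3 * L) (L * k), fun n G _ => explorer_haltsWithQueries G H _ _,
    fun n G _ hfree => explorer_probAnswer_true G H _ _ hfree, fun n G hG hGfar => ?_⟩
  refine le_explorer_probAnswer_false G H _ _ ?_
  rw [← mul_assoc]
  exact (free_le_pow (hfar n G hG hGfar) hD le_rfl le_rfl).trans hk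

/-! ### Packings and colorful copies -/

section Packing

variable {V W : Type*} {H : SimpleGraph W} {G : SimpleGraph V}

/-- The maps that embed `H` into the graph with edge set `Y` and are colorful for `χ`: the image
of the vertex `a` has color `a`. These are not bundled copies, as `Y` will vary. -/
def colorfulCopies (H : SimpleGraph W) (χ : V → W) (Y : Set (Sym2 V)) : Set (W → V) :=
  {φ | Function.LeftInverse χ φ ∧ ∀ a b, H.Adj a b → s(φ a, φ b) ∈ Y}

theorem colorfulCopies_mono {χ : V → W} {Y Z : Set (Sym2 V)} (h : Y ⊆ Z) :
    colorfulCopies H χ Y ⊆ colorfulCopies H χ Z :=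
  fun _ hφ => ⟨hφ.1, fun a b hab => h (hφ.2 a b hab)⟩

theorem exists_maximal_edgeDisjoint_copies [Finite V] [Finite W] (hH : H ≠ ⊥) :
    ∃ P : Finset (H.Copy G),
      (P : Set (H.Copy G)).PairwiseDisjoint (fun f => Sym2.map f '' H.edgeSet) ∧
      H.Free (G.deleteEdges (⋃ f ∈ P, Sym2.map f '' H.edgeSet)) := by
  classical
  have : Finite (H.Copy G) := DFunLike.finite _
  let edges (f : H.Copy G) : Set (Sym2 V) := Sym2.map f '' H.edgeSet
  let packings : Set (Finset (H.Copy G)) := {P | (P : Set (H.Copy G)).PairwiseDisjoint edges}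
  obtain ⟨P, hP⟩ := (Set.toFinite packings).exists_maximal ⟨∅, by simp [packings]⟩
  refine ⟨P, hP.prop, ?_⟩
  rintro ⟨g⟩
  let f : H.Copy G := (SimpleGraph.Copy.ofLE _ _ (G.deleteEdges_le _)).comp g
  have hf : ∀ e ∈ H.edgeSet, ∀ f' ∈ P, Sym2.map f e ∉ edges f' := by
    intro e he f' hf' hmem
    induction e with | _ a b =>
    have hab := g.toHom.map_adj he
    rw [SimpleGraph.deleteEdges_adj] at hab
    exact hab.2 (Set.mem_biUnion hf' hmem)
  have hdisj : (↑(insert f P) : Set (H.Copy G)).PairwiseDisjoint edges := by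
    rw [Finset.coe_insert]
    refine hP.prop.insert fun f' hf' _ => Set.disjoint_left.2 ?_
    rintro _ ⟨e, he, rfl⟩
    exact hf e he f' hf'
  have hfP : f ∈ P := hP.le_of_ge hdisj (Finset.subset_insert f P) (Finset.mem_insert_self f P)
  obtain ⟨e, he⟩ := SimpleGraph.edgeSet_nonempty.2 hH
  exact hf e he f hfP (Set.mem_image_of_mem _ he)

open Classical in
theorem card_pow_le_mul_card_leftInverse [Fintype V] [Fintype W] {φ : W → V}
    (hφ : Function.Injective φ) :
    Fintype.card W ^ Fintype.card V ≤
      Fintype.card W ^ Fintype.card W * #{χ : V → W | Function.LeftInverse χ φ} := by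
  rw [← Fintype.card_subtype, ← Fintype.card_fun, ← Fintype.card_fun, ← Fintype.card_prod]
  refine Fintype.card_le_of_injective
    (fun χ => (χ ∘ φ, ⟨Function.extend φ id χ, fun a => hφ.extend_apply _ _ _⟩)) ?_
  intro χ χ' h
  simp only [Prod.mk.injEq, Subtype.mk.injEq] at h
  funext v
  by_cases hv : ∃ a, φ a = v
  · obtain ⟨a, rfl⟩ := hv
    exact congrFun h.1 a
  · simpa only [Function.extend_apply' _ _ _ hv] using congrFun h.2 v

open Classical in
theorem exists_card_le_mul_card_leftInverse [Finite V] [Fintype W] [Nonempty W] {ι : Type*}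
    (P : Finset ι) {φ : ι → W → V} (hφ : ∀ i ∈ P, Function.Injective (φ i)) :
    ∃ χ : V → W,
      #P ≤ Fintype.card W ^ Fintype.card W * #{i ∈ P | Function.LeftInverse χ (φ i)} := by
  cases nonempty_fintype V
  suffices h : ∑ _χ : V → W, #P ≤ ∑ χ : V → W,
      Fintype.card W ^ Fintype.card W * #{i ∈ P | Function.LeftInverse χ (φ i)} by
    simpa using Finset.exists_le_of_sum_le Finset.univ_nonempty h
  calc ∑ _χ : V → W, #P = ∑ _i ∈ P, Fintype.card W ^ Fintype.card V := by
        simp [mul_comm]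
    _ ≤ ∑ i ∈ P, Fintype.card W ^ Fintype.card W * #{χ : V → W | Function.LeftInverse χ (φ i)} :=
        Finset.sum_le_sum fun i hi => card_pow_le_mul_card_leftInverse (hφ i hi)
    _ = ∑ χ : V → W,
          Fintype.card W ^ Fintype.card W * #{i ∈ P | Function.LeftInverse χ (φ i)} := by
        simp only [← Finset.mul_sum, Finset.card_filter]
        rw [Finset.sum_comm]

theorem card_le_ncard_of_pairwiseDisjoint {ι α : Type*} {P : Finset ι} {A : ι → Set α}
    {X : Set α} (hX : X.Finite) (hP : (P : Set ι).PairwiseDisjoint A)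
    (h : ∀ i ∈ P, (A i ∩ X).Nonempty) : #P ≤ X.ncard := by
  rcases P.eq_empty_or_nonempty with rfl | ⟨i, hi⟩
  · simp
  have : Nonempty α := ⟨(h i hi).some⟩
  choose! x hx using h
  rw [← Set.ncard_coe_finset]
  refine Set.ncard_le_ncard_of_injOn x (fun i hi => (hx i hi).2) (fun i hi j hj hij => ?_) hX
  exact hP.elim_set hi hj (x i) (hx i hi).1 (hij ▸ (hx j hj).1)

/-- A random coloring keeps a `|W| ^ (-|W|)` fraction of the copies in a maximal packing
colorful, and destroying these takes a deleted edge for each. -/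
theorem exists_coloring_of_lt_ncard [Finite V] [Fintype W] (hH : H ≠ ⊥) {x : ℝ}
    (hx : ∀ E : Set (Sym2 V), H.Free (G.deleteEdges E) → x < E.ncard) :
    ∃ χ : V → W, ∀ Y : Set (Sym2 V), colorfulCopies H χ Y = ∅ →
      x < ((G.edgeSet \ Y).ncard * (H.edgeSet.ncard * Fintype.card W ^ Fintype.card W) : ℕ) := by
  classical
  have : Nonempty W := by
    obtain ⟨a, -⟩ := SimpleGraph.ne_bot_iff_exists_adj.1 hH
    exact ⟨a⟩
  obtain ⟨P, hdisj, hfree⟩ := exists_maximal_edgeDisjoint_copies (G := G) hH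
  have hcard : (⋃ f ∈ P, Sym2.map f '' H.edgeSet).ncard ≤ #P * H.edgeSet.ncard := by
    refine (P.set_ncard_biUnion_le _).trans (Finset.sum_le_card_nsmul _ _ _ fun f _ => ?_)
    exact Set.ncard_image_le (Set.toFinite _)
  obtain ⟨χ, hχ⟩ := exists_card_le_mul_card_leftInverse P (φ := fun f => ⇑f) fun f _ => f.injective
  refine ⟨χ, fun Y hY => (hx _ hfree).trans_le ?_⟩
  have hlost : #(P.filter fun f : H.Copy G => Function.LeftInverse χ f) ≤
      (G.edgeSet \ Y).ncard := by
    refine card_le_ncard_of_pairwiseDisjoint (Set.toFinite _)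
      (hdisj.subset (Finset.filter_subset _ _)) fun f hf => ?_
    by_contra hall
    refine (hY ▸ Set.notMem_empty _ : (f : W → V) ∉ colorfulCopies H χ Y)
      ⟨(Finset.mem_filter.1 hf).2, fun a b hab => ?_⟩
    by_contra hab'
    exact hall ⟨s(f a, f b), ⟨s(a, b), hab, rfl⟩, f.toHom.map_adj hab, hab'⟩
  refine Nat.cast_le.2 (hcard.trans ?_)
  calc #P * H.edgeSet.ncard
      ≤ Fintype.card W ^ Fintype.card W * (G.edgeSet \ Y).ncard * H.edgeSet.ncard := by
        gcongr
        exact hχ.trans (Nat.mul_le_mul_left _ hlost)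
    _ = (G.edgeSet \ Y).ncard * (H.edgeSet.ncard * Fintype.card W ^ Fintype.card W) := by ring

end Packing

/-! ### Cleaning -/

/-- Iterating deletion rules: every rule that deletes elements does so once, and it pays for this
with its weight. -/
theorem exists_subset_forall_rule {α ι : Type*} [Finite α] [Fintype ι] (X : Set α) (D : ℕ)
    (w : ι → ℕ) {R : ι → Set α → Set α} (hR : ∀ i Y, R i Y ⊆ Y) (hmono : ∀ i, Monotone (R i)) :
    ∃ Y ⊆ X, D * (X \ Y).ncard ≤ ∑ i, w i ∧
      ∀ i, (R i Y).Nonempty → w i < D * (R i Y).ncard := by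
  classical
  obtain ⟨Y, hY⟩ := (Set.toFinite {Y | Y ⊆ X ∧
    D * (X \ Y).ncard ≤ ∑ i with R i Y = ∅, w i}).exists_minimal ⟨X, by simp⟩
  refine ⟨Y, hY.prop.1, hY.prop.2.trans (Finset.sum_le_univ_sum_of_nonneg fun _ => Nat.zero_le _),
    fun i hi => ?_⟩
  by_contra! hle
  have hempty : R i (Y \ R i Y) = ∅ := by
    refine Set.eq_empty_of_forall_notMem fun e he => (hR i _ he).2 ?_
    exact hmono i Set.sdiff_subset he
  have hcard : (X \ (Y \ R i Y)).ncard ≤ (X \ Y).ncard + (R i Y).ncard := by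
    refine (Set.ncard_le_ncard ?_ (Set.toFinite _)).trans (Set.ncard_union_le _ _)
    rw [Set.sdiff_sdiff_right]
    exact Set.union_subset_union_right _ Set.inter_subset_right
  have hsum : w i + ∑ j with R j Y = ∅, w j ≤ ∑ j with R j (Y \ R i Y) = ∅, w j := by
    rw [← Finset.sum_insert (a := i) (by simpa using hi.ne_empty)]
    refine Finset.sum_le_sum_of_subset fun j hj => ?_
    simp only [Finset.mem_insert, Finset.mem_filter_univ] at hj ⊢
    rcases hj with rfl | hj
    · exact hempty
    · exact Set.subset_empty_iff.1 (hj ▸ hmono j Set.sdiff_subset)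
  have hmem := hY.le_of_le (y := Y \ R i Y) ⟨Set.sdiff_subset.trans hY.prop.1, ?_⟩ Set.sdiff_subset
  · obtain ⟨e, he⟩ := hi
    exact (hmem (hR i Y he)).2 he
  · calc D * (X \ (Y \ R i Y)).ncard ≤ D * (X \ Y).ncard + D * (R i Y).ncard := by
          rw [← mul_add]; gcongr
      _ ≤ w i + ∑ j with R j Y = ∅, w j := by rw [add_comm]; gcongr; exact hY.prop.2
      _ ≤ _ := hsum

section UpEdges

variable {V : Type*} {G : SimpleGraph V} {le : V → V → Prop}

theorem IsTreeOrder.level_lt_level [Finite V] (hle : IsTreeOrder le) {u v : V} (huv : le u v)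
    (hne : u ≠ v) : level le u < level le v := by
  refine Set.ncard_lt_ncard ⟨fun x hx => ⟨hle.trans _ _ _ hx.1 huv, ?_⟩, fun h => ?_⟩
    (Set.toFinite _)
  · rintro rfl
    exact hx.2 (hle.antisymm _ _ hx.1 huv)
  · exact (h ⟨huv, hne⟩ : u ∈ {x | le x u ∧ x ≠ u}).2 rfl

theorem IsTreeOrder.card_subtype_le [Finite V] (hle : IsTreeOrder le) (u : V) :
    Nat.card {v // le v u} = level le u + 1 := by
  rw [level, ← Set.ncard_insert_of_notMem (a := u) (by simp) (Set.toFinite _),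
    ← Nat.card_coe_set_eq]
  congr! 3 with v
  by_cases h : v = u <;> simp [h, hle.refl]

/-- The pairs of `v` with a smaller vertex. For a tree embedding of a graph, every edge
has this form for its larger endpoint `v`. -/
def upEdges (le : V → V → Prop) (v : V) : Set (Sym2 V) :=
  (fun u => s(u, v)) '' {u | le u v ∧ u ≠ v}

theorem ncard_upEdges_le [Finite V] (le : V → V → Prop) (v : V) :
    (upEdges le v).ncard ≤ level le v :=
  Set.ncard_image_le (Set.toFinite _)

theorem IsTreeEmbedding.edgeSet_subset_iUnion_upEdges (hle : IsTreeEmbedding G le) :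
    G.edgeSet ⊆ ⋃ v, upEdges le v := by
  intro e he
  induction e with | _ u v =>
  have huv : G.Adj u v := he
  rcases hle.comparable u v huv with h | h
  · exact Set.mem_iUnion.2 ⟨v, u, ⟨h, huv.ne⟩, rfl⟩
  · exact Set.mem_iUnion.2 ⟨u, v, ⟨h, huv.ne'⟩, Sym2.eq_swap⟩

theorem IsTreeEmbedding.ncard_edgeSet_le [Fintype V] (hle : IsTreeEmbedding G le)
    {d : ℕ} (hd : ∀ v, level le v ≤ d) : G.edgeSet.ncard ≤ Fintype.card V * d :=
  calc G.edgeSet.ncard ≤ (⋃ v, upEdges le v).ncard :=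
        Set.ncard_le_ncard hle.edgeSet_subset_iUnion_upEdges (Set.toFinite _)
    _ ≤ ∑ v, (upEdges le v).ncard := Set.ncard_iUnion_le_of_fintype _
    _ ≤ Fintype.card V * d := Finset.sum_le_card_nsmul _ _ _ fun v _ =>
        (ncard_upEdges_le le v).trans (hd v)

theorem sum_ncard_neighborSet [Fintype V] (G : SimpleGraph V) :
    ∑ v, (G.neighborSet v).ncard = 2 * G.edgeSet.ncard := by
  classical
  simpa only [← SimpleGraph.card_neighborFinset_eq_degree, ← SimpleGraph.coe_neighborFinset,
    ← SimpleGraph.coe_edgeFinset, Set.ncard_coe_finset] using G.sum_degrees_eq_twice_card_edges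

theorem IsTreeEmbedding.sum_ncard_neighborSet_le [Fintype V] (hle : IsTreeEmbedding G le) {d : ℕ}
    (hd : ∀ v, level le v ≤ d) : ∑ v, (G.neighborSet v).ncard ≤ 2 * (Nat.card V * d) := by
  rw [sum_ncard_neighborSet, Nat.card_eq_fintype_card]
  exact Nat.mul_le_mul_left 2 (hle.ncard_edgeSet_le hd)

end UpEdges

section IsClean

variable {V W : Type*} {H : SimpleGraph W} {G : SimpleGraph V} {χ : V → W} {le : V → V → Prop}

/-- The edges of `Y` from the image of `h` under a colorful copy up to this image; deleting them
deletes all copies if they are too few to find the image of `h` by drawing a random vertex. -/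
def rootEdges (H : SimpleGraph W) (χ : V → W) (le : V → V → Prop) (h : W) (Y : Set (Sym2 V)) :
    Set (Sym2 V) :=
  {e ∈ Y | ∃ φ ∈ colorfulCopies H χ Y, e ∈ upEdges le (φ h)}

/-- The edges of `Y` from `u` to the image of `b` under a colorful copy that uses `u` and has the
trace `S` on the vertices below `u`. As the colors determine which vertex of `H` is mapped to a
vertex in the trace, these copies agree on all vertices of `H` mapped below `u`. -/
def traceEdges (H : SimpleGraph W) (χ : V → W) (le : V → V → Prop) (u : V) (b : W)
    (S : Set {v // le v u}) (Y : Set (Sym2 V)) : Set (Sym2 V) :=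
  {e ∈ Y | ∃ φ ∈ colorfulCopies H χ Y, φ (χ u) = u ∧ Subtype.val ⁻¹' Set.range φ = S ∧
    s(u, φ b) = e}

/-- A set of edges in which every copy of `H` that is colorful for `χ` can be extended by random
exploration: `up` for a query at a known vertex that reveals a smaller one, `root` for a random draw
when the known vertices have no unknown neighbors, `trace` for a query that reveals a larger
vertex. -/
structure IsClean (H : SimpleGraph W) (G : SimpleGraph V) (χ : V → W) (le : V → V → Prop) (D : ℕ)
    (Y : Set (Sym2 V)) : Prop where
  subset : Y ⊆ G.edgeSet
  up : ∀ u v, s(u, v) ∈ Y → le u v → (G.neighborSet v).ncard ≤ D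
  root : ∀ φ ∈ colorfulCopies H χ Y, ∀ a b, H.Adj a b → le (φ b) (φ a) →
    Nat.card V ≤ D * (extensions (colorfulCopies H χ Y) φ ∅ a).ncard
  trace : ∀ φ ∈ colorfulCopies H χ Y, ∀ a b, H.Adj a b →
    (G.neighborSet (φ a)).ncard ≤
      D * (extensions (colorfulCopies H χ Y) φ {x | le (φ x) (φ a)} b).ncard

theorem rootEdges_mono (h : W) : Monotone (rootEdges H χ le h) :=
  fun _ _ hYZ _ ⟨he, φ, hφ, hup⟩ => ⟨hYZ he, φ, colorfulCopies_mono hYZ hφ, hup⟩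

theorem traceEdges_mono (u : V) (b : W) (S : Set {v // le v u}) :
    Monotone (traceEdges H χ le u b S) :=
  fun _ _ hYZ _ ⟨he, φ, hφ, h⟩ => ⟨hYZ he, φ, colorfulCopies_mono hYZ hφ, h⟩

theorem ncard_rootEdges_le [Finite V] {d : ℕ} (hd : ∀ v, level le v ≤ d) (φ : W → V) (h : W)
    (Y : Set (Sym2 V)) :
    (rootEdges H χ le h Y).ncard ≤ d * (extensions (colorfulCopies H χ Y) φ ∅ h).ncard := by
  set X := extensions (colorfulCopies H χ Y) φ ∅ h
  calc (rootEdges H χ le h Y).ncard ≤ (⋃ v ∈ X, upEdges le v).ncard := by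
        refine Set.ncard_le_ncard ?_ (Set.toFinite _)
        rintro e ⟨-, ψ, hψ, he⟩
        exact Set.mem_biUnion ⟨ψ, hψ, Set.eqOn_empty _ _, rfl⟩ he
    _ ≤ ∑ v ∈ (Set.toFinite X).toFinset, (upEdges le v).ncard := by
        simpa using (Set.toFinite X).toFinset.set_ncard_biUnion_le (upEdges le)
    _ ≤ (Set.toFinite X).toFinset.card * d := Finset.sum_le_card_nsmul _ _ _ fun v _ =>
        (ncard_upEdges_le le v).trans (hd v)
    _ = d * X.ncard := by rw [mul_comm, Set.ncard_eq_toFinset_card]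

theorem ncard_traceEdges_le [Finite V] {Y : Set (Sym2 V)} {φ : W → V}
    (hφ : φ ∈ colorfulCopies H χ Y) (a b : W) :
    (traceEdges H χ le (φ a) b (Subtype.val ⁻¹' Set.range φ) Y).ncard ≤
      (extensions (colorfulCopies H χ Y) φ {x | le (φ x) (φ a)} b).ncard := by
  refine (Set.ncard_le_ncard (t := (fun v => s(φ a, v)) '' _) ?_ (Set.toFinite _)).trans
    (Set.ncard_image_le (Set.toFinite _))
  rintro e ⟨-, ψ, hψ, -, htrace, he⟩
  refine ⟨ψ b, ⟨ψ, hψ, fun x hx => ?_, rfl⟩, he⟩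
  have hmem : (⟨φ x, hx⟩ : {v // le v (φ a)}) ∈ Subtype.val ⁻¹' Set.range ψ :=
    htrace ▸ Set.mem_range_self x
  obtain ⟨y, hy : ψ y = φ x⟩ := hmem
  have hyx : y = x := by rw [← hψ.1 y, hy, hφ.1 x]
  exact hyx ▸ hy

theorem isClean_of_lt_mul_ncard [Finite V] {D d : ℕ} {Y : Set (Sym2 V)}
    (hd : ∀ v, level le v ≤ d) (hY : Y ⊆ G.edgeSet)
    (hup : ∀ v, (Y ∩ upEdges le v).Nonempty →
      d * (G.neighborSet v).ncard < D * (Y ∩ upEdges le v).ncard)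
    (hroot : ∀ h, (rootEdges H χ le h Y).Nonempty →
      d * Nat.card V < D * (rootEdges H χ le h Y).ncard)
    (htrace : ∀ u b S, (traceEdges H χ le u b S Y).Nonempty →
      (G.neighborSet u).ncard < D * (traceEdges H χ le u b S Y).ncard) :
    IsClean H G χ le D Y where
  subset := hY
  up u v huv h := by
    have hlt := hup v ⟨s(u, v), huv, u, ⟨h, (hY huv : G.Adj u v).ne⟩, rfl⟩
    have hcard : (Y ∩ upEdges le v).ncard ≤ d :=
      (Set.ncard_inter_le_ncard_right _ _ (Set.toFinite _)).trans
        ((ncard_upEdges_le le v).trans (hd v))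
    refine (Nat.lt_of_mul_lt_mul_left (a := d) (hlt.trans_le ?_)).le
    rw [mul_comm d]
    gcongr
  root φ hφ a b hab hba := by
    have hba' : φ b ≠ φ a := (hY (hφ.2 a b hab) : G.Adj (φ a) (φ b)).ne'
    have hlt := hroot a ⟨s(φ b, φ a), hφ.2 b a hab.symm, φ, hφ, φ b, ⟨hba, hba'⟩, rfl⟩
    refine (Nat.lt_of_mul_lt_mul_left (a := d) (hlt.trans_le ?_)).le
    rw [mul_left_comm]
    gcongr
    exact ncard_rootEdges_le hd φ a Y
  trace φ hφ a b hab := by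
    refine (htrace (φ a) b _ ⟨_, hφ.2 a b hab, φ, hφ, by rw [hφ.1 a], rfl, rfl⟩).le.trans ?_
    gcongr
    exact ncard_traceEdges_le hφ a b

theorem sum_mul_card_trace_le [Fintype V] {d : ℕ} (hle : IsTreeEmbedding G le)
    (hd : ∀ v, level le v ≤ d) :
    ∑ u, Nat.card (Set {v // le v u}) * (G.neighborSet u).ncard ≤
      2 ^ (d + 1) * (2 * (Nat.card V * d)) := by
  have htrace (u : V) : Nat.card (Set {v // le v u}) ≤ 2 ^ (d + 1) := by
    classical
    rw [Nat.card_eq_fintype_card, Fintype.card_set, ← Nat.card_eq_fintype_card,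
      hle.isTreeOrder.card_subtype_le u]
    gcongr
    · norm_num
    · exact hd u
  calc ∑ u, Nat.card (Set {v // le v u}) * (G.neighborSet u).ncard
      ≤ ∑ u, 2 ^ (d + 1) * (G.neighborSet u).ncard := by gcongr; exact htrace _
    _ ≤ 2 ^ (d + 1) * (2 * (Nat.card V * d)) := by
        rw [← Finset.mul_sum]
        exact Nat.mul_le_mul_left _ (hle.sum_ncard_neighborSet_le hd)

theorem exists_isClean [Finite V] [Finite W] {d : ℕ} (H : SimpleGraph W) (χ : V → W)
    (hle : IsTreeEmbedding G le) (hd : ∀ v, level le v ≤ d) (D : ℕ) :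
    ∃ Y, IsClean H G χ le D Y ∧ D * (G.edgeSet \ Y).ncard ≤
      (2 * d ^ 2 + Nat.card W * d + Nat.card W * 2 ^ (d + 2) * d) * Nat.card V := by
  cases nonempty_fintype V
  cases nonempty_fintype W
  have (u : V) : Fintype (Set {v // le v u}) := Fintype.ofFinite _
  let ι := V ⊕ W ⊕ Σ u : V, W × Set {v // le v u}
  let R : ι → Set (Sym2 V) → Set (Sym2 V) :=
    Sum.elim (fun v Y => Y ∩ upEdges le v) <| Sum.elim (fun h => rootEdges H χ le h)
      fun i => traceEdges H χ le i.1 i.2.1 i.2.2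
  let w : ι → ℕ := Sum.elim (fun v => d * (G.neighborSet v).ncard) <|
    Sum.elim (fun _ => d * Nat.card V) fun i => (G.neighborSet i.1).ncard
  have hR : ∀ i Y, R i Y ⊆ Y
    | .inl _, _ => Set.inter_subset_left
    | .inr (.inl _), _ => Set.sep_subset _ _
    | .inr (.inr _), _ => Set.sep_subset _ _
  have hmono : ∀ i, Monotone (R i)
    | .inl _ => fun _ _ h => Set.inter_subset_inter_left _ h
    | .inr (.inl h) => rootEdges_mono h
    | .inr (.inr ⟨u, b, S⟩) => traceEdges_mono u b S
  obtain ⟨Y, hY, hcard, hrule⟩ := exists_subset_forall_rule G.edgeSet D w hR hmono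
  have hclean : IsClean H G χ le D Y :=
    isClean_of_lt_mul_ncard hd hY (fun v => hrule (.inl v)) (fun h => hrule (.inr (.inl h)))
      fun u b S => hrule (.inr (.inr ⟨u, b, S⟩))
  refine ⟨Y, hclean, hcard.trans ?_⟩
  have hdeg := hle.sum_ncard_neighborSet_le hd
  calc ∑ i, w i = d * ∑ v, (G.neighborSet v).ncard + (Nat.card W * (d * Nat.card V) +
        Nat.card W * ∑ u, Nat.card (Set {v // le v u}) * (G.neighborSet u).ncard) := by
        simp [w, ι, Fintype.sum_sum_type, Fintype.sum_sigma, Finset.mul_sum, mul_assoc]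
    _ ≤ d * (2 * (Nat.card V * d)) + (Nat.card W * (d * Nat.card V) +
        Nat.card W * (2 ^ (d + 1) * (2 * (Nat.card V * d)))) := by
        gcongr
        exact sum_mul_card_trace_le hle hd
    _ = _ := by ring

end IsClean

/-! ### Clean sets are explorable -/

section Extend

variable {V W : Type*} {H : SimpleGraph W} {G : SimpleGraph V} {χ : V → W} {le : V → V → Prop}

/-- A copy that agrees with `φ` on the boundary `K'` of `C` can be glued to `φ` along it. -/
theorem extensions_colorfulCopies_subset {Y : Set (Sym2 V)} {φ : W → V}
    (hφ : φ ∈ colorfulCopies H χ Y) {K K' C : Set W} (hC : Disjoint C K)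
    (hK' : ∀ a ∈ C, ∀ b ∉ C, H.Adj a b → b ∈ K') {c : W} (hc : c ∈ C) :
    extensions (colorfulCopies H χ Y) φ K' c ⊆ extensions (colorfulCopies H χ Y) φ K c := by
  classical
  rintro v ⟨ψ, hψ, hψφ, rfl⟩
  have hedge : ∀ a b, H.Adj a b → a ∈ C → b ∉ C → s(ψ a, φ b) ∈ Y := fun a b hab ha hb =>
    hψφ (hK' a ha b hb hab) ▸ hψ.2 a b hab
  refine ⟨C.piecewise ψ φ, ⟨fun a => ?_, fun a b hab => ?_⟩, fun a ha => ?_, ?_⟩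
  · by_cases ha : a ∈ C <;> simp [ha, hφ.1 a, hψ.1 a]
  · by_cases ha : a ∈ C <;> by_cases hb : b ∈ C <;> simp only [ha, hb, Set.piecewise_eq_of_mem,
      Set.piecewise_eq_of_notMem, not_false_eq_true]
    · exact hψ.2 a b hab
    · exact hedge a b hab ha hb
    · exact Sym2.eq_swap ▸ hedge b a hab.symm hb ha
    · exact hφ.2 a b hab
  · exact Set.piecewise_eq_of_notMem _ _ _ (hC.notMem_of_mem_right ha)
  · exact Set.piecewise_eq_of_mem _ _ _ hc

namespace IsClean

variable {D : ℕ} {Y : Set (Sym2 V)} {φ : W → V}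

theorem ncard_neighborSet_le_of_le [Finite V] (hY : IsClean H G χ le D Y)
    (hφ : φ ∈ colorfulCopies H χ Y) {a b : W} (hab : H.Adj a b) (hba : le (φ b) (φ a)) (K : Set W) :
    (G.neighborSet (φ a)).ncard ≤ D * (extensions (colorfulCopies H χ Y) φ K b).ncard := by
  have hpos : 0 < (extensions (colorfulCopies H χ Y) φ K b).ncard :=
    (Set.ncard_pos (Set.toFinite _)).2 ⟨_, mem_extensions_self hφ K b⟩
  exact (hY.up (φ b) (φ a) (hφ.2 b a hab.symm) hba).trans (Nat.le_mul_of_pos_right D hpos)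

theorem card_le_of_forall_not_adj [Finite V] (hY : IsClean H G χ le D Y)
    (hφ : φ ∈ colorfulCopies H χ Y) {K : Set W} (hK : ∀ a ∈ K, ∀ b ∉ K, ¬H.Adj a b)
    {a b : W} (ha : a ∉ K) (hab : H.Adj a b) (hba : le (φ b) (φ a)) :
    Nat.card V ≤ D * (extensions (colorfulCopies H χ Y) φ K a).ncard := by
  refine (hY.root φ hφ a b hab hba).trans (Nat.mul_le_mul_left D (Set.ncard_le_ncard ?_
    (Set.toFinite _)))
  refine extensions_colorfulCopies_subset hφ (C := Kᶜ) disjoint_compl_left (fun x hx y hy hxy => ?_)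
    ha
  exact (hK y (not_not.1 hy) x hx hxy.symm).elim

/-- If the crossing edge `ab` has the largest possible level at its known end, then the vertices
above `φ a` are only joined to the rest of the copy by vertices below `φ a`. -/
theorem ncard_neighborSet_le_of_forall_level_le [Finite V] (hY : IsClean H G χ le D Y)
    (hle : IsTreeEmbedding G le) (hφ : φ ∈ colorfulCopies H χ Y) {K : Set W} {a b : W}
    (hb : b ∉ K) (hab : H.Adj a b) (hle_ab : le (φ a) (φ b))
    (hmax : ∀ x ∈ K, ∀ y ∉ K, H.Adj x y → level le (φ x) ≤ level le (φ a)) :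
    (G.neighborSet (φ a)).ncard ≤ D * (extensions (colorfulCopies H χ Y) φ K b).ncard := by
  refine (hY.trace φ hφ a b hab).trans (Nat.mul_le_mul_left D (Set.ncard_le_ncard ?_
    (Set.toFinite _)))
  refine extensions_colorfulCopies_subset hφ (C := {x | x ∉ K ∧ le (φ a) (φ x)})
    (Set.disjoint_left.2 fun x hx => hx.1) ?_ ⟨hb, hle_ab⟩
  rintro x ⟨hx, hax⟩ y hy hxy
  have hxy' : G.Adj (φ x) (φ y) := hY.subset (hφ.2 x y hxy)
  have below_or_above : le (φ y) (φ a) ∨ le (φ a) (φ y) := by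
    rcases hle.comparable _ _ hxy' with h | h
    · exact .inr (hle.isTreeOrder.trans _ _ _ hax h)
    · exact hle.isTreeOrder.total_below _ _ _ h hax
  by_contra hnot
  have hay := below_or_above.resolve_left hnot
  have hne : φ a ≠ φ y := fun h => hnot (h ▸ hle.isTreeOrder.refl _)
  have hyK : y ∈ K := by
    by_contra hyK
    exact hy ⟨hyK, hay⟩
  exact (hle.isTreeOrder.level_lt_level hay hne).not_ge (hmax y hyK x hx hxy.symm)

theorem exists_extension [Finite V] [Finite W] (hY : IsClean H G χ le D Y)
    (hle : IsTreeEmbedding G le) (hφ : φ ∈ colorfulCopies H χ Y) {K : H.Subgraph}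
    (hK : K.spanningCoe < H) :
    (∃ c ∉ K.verts, Nat.card V ≤ D * (extensions (colorfulCopies H χ Y) φ K.verts c).ncard) ∨
      ∃ c ∈ K.verts, ∃ c', H.Adj c c' ∧ ¬K.Adj c c' ∧ (G.neighborSet (φ c)).ncard ≤
        D * (extensions (colorfulCopies H χ Y) φ K.verts c').ncard := by
  have hcomp {x y : W} (hxy : H.Adj x y) : le (φ x) (φ y) ∨ le (φ y) (φ x) :=
    hle.comparable _ _ (hY.subset (hφ.2 x y hxy))
  obtain ⟨a, b, hab, hKab, hba⟩ : ∃ a b, H.Adj a b ∧ ¬K.Adj a b ∧ le (φ b) (φ a) := by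
    obtain ⟨a, b, hab, hKab⟩ : ∃ a b, H.Adj a b ∧ ¬K.Adj a b := by
      by_contra! h
      exact hK.not_ge fun a b hab => h a b hab
    rcases hcomp hab with h | h
    · exact ⟨b, a, hab.symm, fun h' => hKab h'.symm, h⟩
    · exact ⟨a, b, hab, hKab, h⟩
  by_cases ha : a ∈ K.verts
  · exact .inr ⟨a, ha, b, hab, hKab, hY.ncard_neighborSet_le_of_le hφ hab hba _⟩
  let B : Set W := {x ∈ K.verts | ∃ y ∉ K.verts, H.Adj x y}
  rcases B.eq_empty_or_nonempty with hB | hB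
  · refine .inl ⟨a, ha, hY.card_le_of_forall_not_adj hφ (fun x hx y hy hxy => ?_) ha hab hba⟩
    exact Set.notMem_empty x (hB ▸ ⟨hx, y, hy, hxy⟩ : x ∈ (∅ : Set W))
  · obtain ⟨c, ⟨hc, c', hc', hadj⟩, hmax⟩ :=
      Set.exists_max_image B (fun x => level le (φ x)) (Set.toFinite B) hB
    refine .inr ⟨c, hc, c', hadj, fun h => hc' h.snd_mem, ?_⟩
    rcases hcomp hadj with h | h
    · exact hY.ncard_neighborSet_le_of_forall_level_le hle hφ hc' hadj h
        fun x hx y hy hxy => hmax x ⟨hx, y, hy, hxy⟩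
    · exact hY.ncard_neighborSet_le_of_le hφ hadj h _

theorem isExplorable [Finite V] [Finite W] (hY : IsClean H G χ le D Y)
    (hle : IsTreeEmbedding G le) (hne : (colorfulCopies H χ Y).Nonempty) :
    IsExplorable H G D (colorfulCopies H χ Y) where
  nonempty := hne
  injective _ hφ := hφ.1.injective
  map_adj _ hφ a b hab := hY.subset (hφ.2 a b hab)
  extend _ hφ _ := hY.exists_extension hle hφ

end IsClean

end Extend

theorem exists_isTreeEmbedding_of_treedepth_le {V : Type*} [Fintype V] {G : SimpleGraph V} {d : ℕ}
    (h : treedepth G ≤ d) :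
    ∃ le : V → V → Prop, IsTreeEmbedding G le ∧ ∀ v, level le v ≤ d := by
  have hne : {k : ℕ | ∃ le : V → V → Prop, IsTreeEmbedding G le ∧ depth le = k}.Nonempty := by
    let e := Fintype.equivFin V
    have horder : IsTreeOrder fun u v => e u ≤ e v :=
      ⟨fun _ => le_rfl, fun _ _ huv hvu => e.injective (le_antisymm huv hvu),
        fun _ _ _ => le_trans, fun _ _ _ _ _ => le_total _ _⟩
    exact ⟨_, _, ⟨horder, fun _ _ _ => le_total _ _⟩, rfl⟩
  obtain ⟨le, hle, hdepth⟩ := Nat.sInf_mem hne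
  refine ⟨le, hle, fun v => (Finset.le_sup (f := level le) (Finset.mem_univ v)).trans ?_⟩
  exact hdepth.le.trans h

theorem isExplorable_singleton {V W : Type*} {G : SimpleGraph V} (D : ℕ)
    (f : (⊥ : SimpleGraph W).Copy G) : IsExplorable ⊥ G D {⇑f} where
  nonempty := Set.singleton_nonempty _
  injective := by rintro _ rfl; exact f.injective
  map_adj := by rintro _ rfl a b hab; exact hab.elim
  extend _ _ _ hK := (not_lt_bot hK).elim

theorem IsFar.lt_ncard {P : GraphClass} {ε : ℝ} {n : ℕ} {G : SimpleGraph (Fin n)} (h : IsFar P ε G)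
    {E : Set (Sym2 (Fin n))} (hE : G.deleteEdges E ∈ P n) : ε * n < E.ncard := by
  refine (h _ hE).trans_le (Nat.cast_le.2 (Set.ncard_le_ncard ?_ (Set.toFinite _)))
  rw [SimpleGraph.edgeSet_deleteEdges]
  rintro e (⟨he, hne⟩ | ⟨⟨he, -⟩, hne⟩)
  · by_contra heE
    exact hne ⟨he, heE⟩
  · exact (hne he).elim

theorem IsFar.isContained {W : Type*} {H : SimpleGraph W} {ε : ℝ} (hε : 0 < ε) {n : ℕ}
    {G : SimpleGraph (Fin n)} (h : IsFar (hFree H) ε G) : H.IsContained G := by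
  by_contra hfree
  have hlt := h G hfree
  rw [symmDiff_self, Set.bot_eq_empty, Set.ncard_empty, Nat.cast_zero] at hlt
  exact hlt.not_ge (by positivity)

theorem exists_isExplorable {W : Type*} [Finite W] (H : SimpleGraph W) (d : ℕ) {ε : ℝ}
    (hε : 0 < ε) :
    ∃ D ≠ 0, ∀ (n : ℕ) (G : SimpleGraph (Fin n)), treedepth G ≤ d → IsFar (hFree H) ε G →
      ∃ Φ, IsExplorable H G D Φ := by
  cases nonempty_fintype W
  let m : ℕ := H.edgeSet.ncard * Fintype.card W ^ Fintype.card W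
  let κ : ℕ := 2 * d ^ 2 + Nat.card W * d + Nat.card W * 2 ^ (d + 2) * d
  obtain ⟨D, hD⟩ := exists_nat_gt ((κ * m : ℝ) / ε)
  have hD0 : 0 < D := Nat.cast_pos.1 (lt_of_le_of_lt (by positivity) hD)
  refine ⟨D, hD0.ne', fun n G hG hfar => ?_⟩
  rcases eq_or_ne H ⊥ with rfl | hH
  · obtain ⟨f⟩ := hfar.isContained hε
    exact ⟨_, isExplorable_singleton D f⟩
  obtain ⟨le, hle, hd⟩ := exists_isTreeEmbedding_of_treedepth_le hG
  obtain ⟨χ, hχ⟩ := exists_coloring_of_lt_ncard hH fun E hE => hfar.lt_ncard hE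
  obtain ⟨Y, hY, hcard⟩ := exists_isClean H χ hle hd D
  refine ⟨_, hY.isExplorable hle (Set.nonempty_iff_ne_empty.2 fun hempty => ?_)⟩
  have hκ : D * (G.edgeSet \ Y).ncard ≤ κ * n := by simpa [κ] using hcard
  have hlt : ε * n * D < ε * n * D := calc
    ε * n * D < ((G.edgeSet \ Y).ncard * m : ℕ) * D := by gcongr; exact hχ Y hempty
    _ = (D * (G.edgeSet \ Y).ncard : ℕ) * m := by push_cast; ring
    _ ≤ (κ * n : ℕ) * m := mul_le_mul_of_nonneg_right (Nat.cast_le.2 hκ) m.cast_nonneg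
    _ = κ * m * n := by push_cast; ring
    _ ≤ D * ε * n := mul_le_mul_of_nonneg_right ((div_lt_iff₀ hε).1 hD).le n.cast_nonneg
    _ = ε * n * D := by ring
  exact lt_irrefl _ hlt

end GraphTesting

theorem mainTheorem2 {W : Type*} [Finite W] (H : SimpleGraph W) (C : GraphTesting.GraphClass)
    (hC : GraphTesting.HasBoundedTreedepth C) :
    GraphTesting.IsTestable (GraphTesting.hFree H) C := by
  intro ε hε
  obtain ⟨d, hd⟩ := hC
  obtain ⟨D, hD, hfar⟩ := GraphTesting.exists_isExplorable H d hε
  exact GraphTesting.exists_isOneSidedTester H hD fun n G hG => hfar n G (hd n G hG)
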